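/- For $n\in\mathbb N=\{0,1,2,\ldots\}$ let $[n]=\{1,\ldots,n\}$ and $[n]'=\{1',\ldots,n'\}$. For $m,n\in\mathbb N$ let $\mathcal B_{mn}$ be the set of Brauer partitions, i.e. the set partitions of $[m]\cup[n]'$ all of whose blocks have size $2$. For $\alpha\in\mathcal B_{mn}$ and $\beta\in\mathcal B_{nk}$, the product $\alpha\beta\in\mathcal B_{mk}$ is defined as follows: let $\Pi(\alpha,\beta)$ be the graph on $[m]\cup[n]''\cup[k]'$ obtained by identifying the lower vertices $x'$ of $\alpha$ with the upper vertices $x$ of $\beta$ (both renamed $x''$) and joining two vertices whenever they lie in a common block of $\alpha$ or of $\beta$; then two elements of $[m]\cup[k]'$ lie in the same block of $\alpha\beta$ if and only if they lie in the same connected component of $\Pi(\alpha,\beta)$. With these products, the sets $\mathcal B_{mn}$ are the hom-sets of the Brauer category $\mathcal B$, whose objects are the natural numbers. The rank of $\alpha\in\mathcal B_{mn}$ is the number of its blocks that meet both $[m]$ and $[n]'$. For $\sigma\in\mathcal B_{nm}$, the sandwich semigroup $\mathcal B_{mn}^\sigma$ is the set $\mathcal B_{mn}$ with the associative operation $\alpha\star_\sigma\beta=\alpha\sigma\beta$.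 Theorem. Let $m,n,k,l\in\mathbb N$ with $m\equiv n\pmod 2$ and $k\equiv l\pmod 2$, and let $\sigma\in\mathcal B_{nm}$ and $\tau\in\mathcal B_{lk}$ with $r=\operatorname{rank}(\sigma)$ and $s=\operatorname{rank}(\tau)$. Then the semigroups $\mathcal B_{mn}^\sigma$ and $\mathcal B_{kl}^\tau$ are isomorphic if and only if one of the following holds: (i) $(m,n,r)=(k,l,s)$; (ii) $m+n\le 2$ and $k+l\le 2$; (iii) up to interchanging $(m,n,r)$ and $(k,l,s)$, we have $(m,n,r)=(2q,0,0)$ and $(k,l,s)=(2q-1,1,1)$ for some integer $q\ge1$; (iv) up to interchanging $(m,n,r)$ and $(k,l,s)$, we have $(m,n,r)=(0,2q,0)$ and $(k,l,s)=(1,2q-1,1)$ for some integer $q\ge1$. -/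

import Mathlib

open CategoryTheory

/-! ## Composition of partitions through the product graph

An element of `𝒫_{mn}` is a set partition of `[m] ∪ [n]'`, encoded as an equivalence relation on the
disjoint sum of the upper vertices and the lower vertices. -/

namespace Diagram

universe u₁ u₂ u₃ u₄

variable {X : Type u₁} {Y : Type u₂} {Z : Type u₃} {W : Type u₄}

/-- The vertices of a diagram `α` from `X` to `Y`, placed in the product graph
on `X ∪ Y'' ∪ Z'`. -/
def upperPart : X ⊕ Y → X ⊕ (Y ⊕ Z) := Sum.map id Sum.inl

/-- The vertices of a diagram `β` from `Y` to `Z`, placed in the product graph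
on `X ∪ Y'' ∪ Z'`. -/
def lowerPart : Y ⊕ Z → X ⊕ (Y ⊕ Z) := Sum.inr

/-- The outer vertices `X ∪ Z'` of the product graph on `X ∪ Y'' ∪ Z'`. -/
def outerPart : X ⊕ Z → X ⊕ (Y ⊕ Z) := Sum.map id Sum.inr

/-- The product of two partitions.  The join of (the images of) `α` and `β` is the
partition of the vertices of the product graph into its connected components, and two outer vertices
are related in the product if they lie in the same component. -/
def comp (α : Setoid (X ⊕ Y)) (β : Setoid (Y ⊕ Z)) : Setoid (X ⊕ Z) :=
  Setoid.comap outerPart (Setoid.map α upperPart ⊔ Setoid.map β lowerPart)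

/-- The identity partition, with blocks `{x, x'}`. -/
def idPartition (X : Type u₁) : Setoid (X ⊕ X) := Setoid.ker (Sum.elim id id)

theorem map_le_iff {P : Type u₁} {Q : Type u₂} {f : P → Q} {r : Setoid P} {s : Setoid Q} :
    Setoid.map r f ≤ s ↔ r ≤ Setoid.comap f s := by
  constructor
  · intro h
    exact Setoid.le_comap_map.trans fun x y hxy => h hxy
  · intro h
    refine Setoid.eqvGen_le ?_
    rintro _ _ ⟨x, y, hxy, rfl, rfl⟩
    exact h hxy

theorem map_sup {P : Type u₁} {Q : Type u₂} (f : P → Q) (r s : Setoid P) :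
    Setoid.map (r ⊔ s) f = Setoid.map r f ⊔ Setoid.map s f := by
  apply le_antisymm
  · rw [map_le_iff]
    exact sup_le (map_le_iff.1 le_sup_left) (map_le_iff.1 le_sup_right)
  · refine sup_le ?_ ?_ <;> rw [map_le_iff]
    · exact le_trans le_sup_left Setoid.le_comap_map
    · exact le_trans le_sup_right Setoid.le_comap_map

theorem map_map {P : Type u₁} {Q : Type u₂} {R : Type u₃} (f : P → Q) (g : Q → R)
    (r : Setoid P) : Setoid.map (Setoid.map r f) g = Setoid.map r (g ∘ f) := by
  apply le_antisymm
  · rw [map_le_iff, map_le_iff]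
    exact Setoid.le_comap_map (f := g ∘ f)
  · rw [map_le_iff]
    intro x y h
    exact Setoid.le_comap_map (f := g) (Setoid.le_comap_map (f := f) h)

theorem comap_sup_map {P : Type u₁} {Q : Type u₂} (f : P → Q) (r : Setoid Q) (s : Setoid P) :
    Setoid.comap f (r ⊔ Setoid.map s f) = Setoid.comap f r ⊔ s := by
  apply le_antisymm
  · let L : Q → Set P := fun t => {v | ∃ v₀, r t (f v₀) ∧ (Setoid.comap f r ⊔ s) v₀ v}
    have hL : ∀ x v, v ∈ L (f x) ↔ (Setoid.comap f r ⊔ s) x v := by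
      intro x v
      constructor
      · rintro ⟨v₀, h₁, h₂⟩
        exact Setoid.trans' _ ((le_sup_left : Setoid.comap f r ≤ _) h₁) h₂
      · intro h
        exact ⟨x, r.refl' _, h⟩
    have hE : r ⊔ Setoid.map s f ≤ Setoid.ker L := by
      refine sup_le ?_ (map_le_iff.2 ?_)
      · intro t t' htt
        ext v
        constructor
        · rintro ⟨v₀, h₁, h₂⟩
          exact ⟨v₀, r.trans' (r.symm' htt) h₁, h₂⟩
        · rintro ⟨v₀, h₁, h₂⟩
          exact ⟨v₀, r.trans' htt h₁, h₂⟩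
      · intro x y hxy
        have hxy' : (Setoid.comap f r ⊔ s) x y := (le_sup_right : s ≤ _) hxy
        change L (f x) = L (f y)
        ext v
        rw [hL, hL]
        exact ⟨fun h => Setoid.trans' _ (Setoid.symm' _ hxy') h,
          fun h => Setoid.trans' _ hxy' h⟩
    intro x y hxy
    have h : L (f x) = L (f y) := hE hxy
    rw [← hL, h, hL]
  · refine sup_le ?_ ?_
    · intro x y h
      exact (le_sup_left : r ≤ r ⊔ Setoid.map s f) h
    · exact map_le_iff.1 le_sup_right

theorem map_comap_of_pullback {A : Type u₁} {B : Type u₂} {C : Type u₃} {D : Type u₄}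
    {f : A → B} {g : A → C} {h : B → D} {k : C → D} (hcomm : h ∘ f = k ∘ g)
    (hh : Function.Injective h) (hk : Function.Injective k)
    (hpb : ∀ b c, h b = k c → ∃ a, f a = b ∧ g a = c) (r : Setoid B) :
    Setoid.map (Setoid.comap f r) g = Setoid.comap k (Setoid.map r h) := by
  apply le_antisymm
  · rw [map_le_iff]
    intro x y hxy
    have h₁ : Setoid.map r h (h (f x)) (h (f y)) := Setoid.le_comap_map (f := h) hxy
    have e : ∀ x, h (f x) = k (g x) := fun x => congrFun hcomm x
    rw [e, e] at h₁
    exact h₁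
  · intro c c' hc
    have h₁ : Setoid.map r h (k c) (k c') := hc
    rw [Setoid.coe_map_of_ker_le r h (Setoid.ker_eq_bot_iff.2 hh ▸ bot_le)] at h₁
    rcases h₁ with ⟨b, b', hbb, e, e'⟩ | e
    · obtain ⟨a, rfl, rfl⟩ := hpb _ _ e
      obtain ⟨a', rfl, rfl⟩ := hpb _ _ e'
      exact Setoid.le_comap_map (f := g) hbb
    · rw [hk e]

theorem comp_assoc (α : Setoid (X ⊕ Y)) (β : Setoid (Y ⊕ Z)) (γ : Setoid (Z ⊕ W)) :
    comp (comp α β) γ = comp α (comp β γ) := by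
  let a : X ⊕ Y → X ⊕ (Y ⊕ (Z ⊕ W)) := Sum.map id Sum.inl
  let b : Y ⊕ Z → X ⊕ (Y ⊕ (Z ⊕ W)) := Sum.inr ∘ Sum.map id Sum.inl
  let c : Z ⊕ W → X ⊕ (Y ⊕ (Z ⊕ W)) := Sum.inr ∘ Sum.inr
  let o : X ⊕ W → X ⊕ (Y ⊕ (Z ⊕ W)) := Sum.map id (Sum.inr ∘ Sum.inr)
  trans Setoid.comap o (Setoid.map α a ⊔ Setoid.map β b ⊔ Setoid.map γ c)
  · let i : X ⊕ (Y ⊕ Z) → X ⊕ (Y ⊕ (Z ⊕ W)) := Sum.map id (Sum.map id Sum.inl)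
    let k : X ⊕ (Z ⊕ W) → X ⊕ (Y ⊕ (Z ⊕ W)) := Sum.map id Sum.inr
    have e : Setoid.map (comp α β) upperPart =
        Setoid.comap k (Setoid.map (Setoid.map α upperPart ⊔ Setoid.map β lowerPart) i) := by
      apply map_comap_of_pullback
      · funext x; rcases x with x | x <;> rfl
      · exact Sum.map_injective.2 ⟨fun _ _ h => h,
          Sum.map_injective.2 ⟨fun _ _ h => h, Sum.inl_injective⟩⟩
      · exact Sum.map_injective.2 ⟨fun _ _ h => h, Sum.inr_injective⟩
      · rintro (x | y | z) (x' | z' | w') h <;>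
          simp only [i, k, Sum.map_inl, Sum.map_inr, id, reduceCtorEq, Sum.inl.injEq,
            Sum.inr.injEq] at h
        · exact ⟨Sum.inl x, rfl, by simp [upperPart, h]⟩
        · exact ⟨Sum.inr z, rfl, by simp [upperPart, h]⟩
    have hα : i ∘ upperPart = a := by funext x; rcases x with x | x <;> rfl
    have hβ : i ∘ lowerPart = b := by funext x; rcases x with x | x <;> rfl
    have hγ : k ∘ lowerPart = c := by funext x; rcases x with x | x <;> rfl
    have ho : k ∘ outerPart = o := by funext x; rcases x with x | x <;> rfl
    change Setoid.comap outerPart (Setoid.map (comp α β) upperPart ⊔ Setoid.map γ lowerPart) = _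
    rw [e, ← comap_sup_map, ← Setoid.comap_comp, map_sup, map_map, map_map, map_map, hα, hβ, hγ,
      ho]
  · let k : X ⊕ (Y ⊕ W) → X ⊕ (Y ⊕ (Z ⊕ W)) := Sum.map id (Sum.map id Sum.inr)
    let i : Y ⊕ (Z ⊕ W) → X ⊕ (Y ⊕ (Z ⊕ W)) := Sum.inr
    have e : Setoid.map (comp β γ) lowerPart =
        Setoid.comap k (Setoid.map (Setoid.map β upperPart ⊔ Setoid.map γ lowerPart) i) := by
      apply map_comap_of_pullback
      · funext x; rcases x with x | x <;> rfl
      · exact Sum.inr_injective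
      · exact Sum.map_injective.2 ⟨fun _ _ h => h,
          Sum.map_injective.2 ⟨fun _ _ h => h, Sum.inr_injective⟩⟩
      · rintro (y | z | w) (x' | y' | w') h <;>
          simp only [i, k, Sum.map_inl, Sum.map_inr, id, reduceCtorEq, Sum.inl.injEq,
            Sum.inr.injEq] at h
        · exact ⟨Sum.inl y, rfl, by simp [lowerPart, h]⟩
        · exact ⟨Sum.inr w, rfl, by simp [lowerPart, h]⟩
    have hα : k ∘ upperPart = a := by funext x; rcases x with x | x <;> rfl
    have hβ : i ∘ upperPart = b := by funext x; rcases x with x | x <;> rfl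
    have hγ : i ∘ lowerPart = c := by funext x; rcases x with x | x <;> rfl
    have ho : k ∘ outerPart = o := by funext x; rcases x with x | x <;> rfl
    change _ = Setoid.comap outerPart (Setoid.map α upperPart ⊔ Setoid.map (comp β γ) lowerPart)
    rw [e, sup_comm (Setoid.map α upperPart) (Setoid.comap k _), ← comap_sup_map k,
      ← Setoid.comap_comp _ k outerPart, map_sup, map_map, map_map, map_map _ k, hα, hβ, hγ, ho,
      sup_comm _ (Setoid.map α a), sup_assoc]

theorem id_comp (β : Setoid (X ⊕ Z)) : comp (idPartition X) β = β := by
  apply le_antisymm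
  · let g : X ⊕ (X ⊕ Z) → X ⊕ Z := Sum.elim Sum.inl id
    have h : Setoid.map (idPartition X) upperPart ⊔ Setoid.map β lowerPart ≤ Setoid.comap g β := by
      refine sup_le (map_le_iff.2 ?_) (map_le_iff.2 fun x y h => h)
      rintro (x | x) (y | y) h <;> obtain rfl : x = y := h <;> exact β.refl' _
    intro p q hpq
    have := h hpq
    rcases p with p | p <;> rcases q with q | q <;> exact this
  · have key : ∀ p : X ⊕ Z, (Setoid.map (idPartition X) upperPart ⊔ Setoid.map β lowerPart)
        (outerPart p) (lowerPart p) := by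
      rintro (x | z)
      · exact (le_sup_left : Setoid.map (idPartition X) upperPart ≤ _)
          (Setoid.le_comap_map (f := upperPart) (r := idPartition X)
            (show idPartition X (Sum.inl x) (Sum.inr x) from rfl))
      · exact Setoid.refl' _ _
    intro p q hpq
    refine Setoid.trans' (Setoid.map (idPartition X) upperPart ⊔ Setoid.map β lowerPart) (key p)
      (Setoid.trans' _ ?_ (Setoid.symm' _ (key q)))
    exact (le_sup_right : Setoid.map β lowerPart ≤ _) (Setoid.le_comap_map hpq)

theorem comp_id (α : Setoid (X ⊕ Y)) : comp α (idPartition Y) = α := by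
  apply le_antisymm
  · let g : X ⊕ (Y ⊕ Y) → X ⊕ Y := Sum.map id (Sum.elim id id)
    have h : Setoid.map α upperPart ⊔ Setoid.map (idPartition Y) lowerPart ≤ Setoid.comap g α := by
      refine sup_le (map_le_iff.2 ?_) (map_le_iff.2 ?_)
      · rintro (x | x) (y | y) h <;> exact h
      · rintro (x | x) (y | y) h <;> obtain rfl : x = y := h <;> exact α.refl' _
    intro p q hpq
    have := h hpq
    rcases p with p | p <;> rcases q with q | q <;> exact this
  · have key : ∀ p : X ⊕ Y, (Setoid.map α upperPart ⊔ Setoid.map (idPartition Y) lowerPart)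
        (outerPart p) (upperPart p) := by
      rintro (x | y)
      · exact Setoid.refl' _ _
      · exact (le_sup_right : Setoid.map (idPartition Y) lowerPart ≤ _)
          (Setoid.le_comap_map (f := lowerPart) (r := idPartition Y)
            (show idPartition Y (Sum.inr y) (Sum.inl y) from rfl))
    intro p q hpq
    refine Setoid.trans' (Setoid.map α upperPart ⊔ Setoid.map (idPartition Y) lowerPart) (key p)
      (Setoid.trans' _ ?_ (Setoid.symm' _ (key q)))
    exact (le_sup_left : Setoid.map α upperPart ≤ _) (Setoid.le_comap_map hpq)

/-! ## Brauer partitions -/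

/-- A Brauer partition: every block has size `2`. -/
def IsBrauer (α : Setoid (X ⊕ Y)) : Prop := ∀ A ∈ α.classes, A.ncard = 2

/-- The rank of a partition: its number of transversals, that is, of blocks with upper and
lower vertices. -/
noncomputable def rank (α : Setoid (X ⊕ Y)) : ℕ :=
  {A ∈ α.classes | (∃ x : X, Sum.inl x ∈ A) ∧ ∃ y : Y, Sum.inr y ∈ A}.ncard

theorem isBrauer_iff_existsUnique (α : Setoid (X ⊕ Y)) :
    IsBrauer α ↔ ∀ u, ∃! v, v ≠ u ∧ α v u := by
  constructor
  · intro h u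
    have hu := h _ (α.mem_classes u)
    obtain ⟨a, b, hab, e⟩ := Set.ncard_eq_two.1 hu
    have hmem : ∀ v, α v u ↔ v = a ∨ v = b := fun v => by
      have := Set.ext_iff.1 e v
      simpa using this
    rcases (hmem u).1 (α.refl' u) with rfl | rfl
    · exact ⟨b, ⟨hab.symm, (hmem b).2 (Or.inr rfl)⟩, fun v hv =>
        ((hmem v).1 hv.2).resolve_left hv.1⟩
    · exact ⟨a, ⟨hab, (hmem a).2 (Or.inl rfl)⟩, fun v hv =>
        ((hmem v).1 hv.2).resolve_right hv.1⟩
  · rintro h _ ⟨u, rfl⟩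
    obtain ⟨v, hv, huniq⟩ := h u
    rw [Set.ncard_eq_two]
    refine ⟨u, v, hv.1.symm, ?_⟩
    ext w
    simp only [Set.mem_ofPred_eq, Set.mem_insert_iff, Set.mem_singleton_iff]
    constructor
    · intro hw
      by_cases hwu : w = u
      · exact Or.inl hwu
      · exact Or.inr (huniq w ⟨hwu, hw⟩)
    · rintro (rfl | rfl)
      · exact α.refl' _
      · exact hv.2

theorem isBrauer_idPartition (X : Type u₁) : IsBrauer (idPartition X) := by
  rw [isBrauer_iff_existsUnique]
  rintro (x | x)
  · refine ⟨Sum.inr x, ⟨by simp, rfl⟩, ?_⟩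
    rintro (y | y) ⟨h₁, h₂⟩ <;> obtain rfl : y = x := h₂
    · exact absurd rfl h₁
    · rfl
  · refine ⟨Sum.inl x, ⟨by simp, rfl⟩, ?_⟩
    rintro (y | y) ⟨h₁, h₂⟩ <;> obtain rfl : y = x := h₂
    · rfl
    · exact absurd rfl h₁

/-- A Brauer partition is the orbit partition of an involution without fixed points. -/
theorem IsBrauer.exists_involutive {α : Setoid (X ⊕ Y)} (h : IsBrauer α) :
    ∃ f : X ⊕ Y → X ⊕ Y, Function.Involutive f ∧ (∀ u, f u ≠ u) ∧
      ∀ u v, α u v ↔ v = u ∨ v = f u := by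
  rw [isBrauer_iff_existsUnique] at h
  choose f hf huniq using h
  refine ⟨f, fun u => ?_, fun u => (hf u).1, fun u v => ?_⟩
  · exact (huniq (f u) u ⟨(hf u).1.symm, α.symm' (hf u).2⟩).symm
  · constructor
    · intro huv
      by_cases hvu : v = u
      · exact Or.inl hvu
      · exact Or.inr (huniq u v ⟨hvu, α.symm' huv⟩)
    · rintro (rfl | rfl)
      · exact α.refl' _
      · exact α.symm' (hf u).2

/-- For two involutions `A`, `B` of a finite set, the orbit under `⟨A, B⟩` of a fixed point `u`
of `B` which is not fixed by `A` holds exactly one further point that is fixed by `A` or `B`. -/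
theorem existsUnique_other_end {V : Type u₁} [Finite V] {A B : V → V} (hA : Function.Involutive A)
    (hB : Function.Involutive B) {r : Setoid V} (hrA : ∀ v, r (A v) v) (hrB : ∀ v, r (B v) v)
    (hmin : ∀ s : Setoid V, (∀ v, s (A v) v) → (∀ v, s (B v) v) → r ≤ s)
    {u : V} (hu : B u = u) (hu' : A u ≠ u) :
    ∃! v, (v ≠ u ∧ r v u) ∧ (A v = v ∨ B v = v) := by
  classical
  let P : Equiv.Perm V := hA.toPerm
  let Q : Equiv.Perm V := hB.toPerm
  let T : Equiv.Perm V := P * Q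
  have hP : ∀ v, P v = A v := fun _ => rfl
  have hQ : ∀ v, Q v = B v := fun _ => rfl
  have hPP : P * P = 1 := Equiv.ext fun v => hA v
  have hQQ : Q * Q = 1 := Equiv.ext fun v => hB v
  have hPi : P⁻¹ = P := inv_eq_of_mul_eq_one_left hPP
  have hQi : Q⁻¹ = Q := inv_eq_of_mul_eq_one_left hQQ
  have hconj : Q * T * Q⁻¹ = T⁻¹ := by
    simp only [T, mul_inv_rev, hPi, hQi, mul_assoc, hQQ, mul_one]
  have hQT : ∀ i : ℤ, B ((T ^ i) u) = (T ^ (-i)) u := by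
    intro i
    have h1 : Q * T ^ i * Q⁻¹ = T ^ (-i) := by
      rw [← conj_zpow, hconj, inv_zpow, zpow_neg]
    have h2 : Q * T ^ i = T ^ (-i) * Q := by
      rw [← h1]; simp [mul_assoc]
    have h3 := congrArg (fun p : Equiv.Perm V => p u) h2
    simpa [hQ, hu] using h3
  have hPT : ∀ i : ℤ, A ((T ^ i) u) = (T ^ (1 - i)) u := by
    intro i
    have h1 : P = T * Q := by simp [T, mul_assoc, hQQ]
    have h2 : A ((T ^ i) u) = T (B ((T ^ i) u)) := by
      rw [← hP, h1]; rfl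
    rw [h2, hQT, sub_eq_add_neg, zpow_add, zpow_one]
    rfl
  have hTr : ∀ v, r (T v) v := fun v => r.trans' (hrA (B v)) (hrB v)
  have hTi : ∀ i : ℤ, r ((T ^ i) u) u := by
    intro i
    induction i using Int.induction_on with
    | zero => exact r.refl' _
    | succ i ih =>
      rw [add_comm, zpow_add, zpow_one]
      exact r.trans' (hTr _) ih
    | pred i ih =>
      rw [sub_eq_add_neg, add_comm, zpow_add, zpow_neg_one]
      have h := hTr (T⁻¹ ((T ^ (-(i : ℤ))) u))
      rw [show T (T⁻¹ ((T ^ (-(i : ℤ))) u)) = (T ^ (-(i : ℤ))) u from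
        T.apply_symm_apply _] at h
      exact r.trans' (r.symm' h) ih
  have hr : ∀ v, r v u → ∃ i : ℤ, (T ^ i) u = v := by
    intro v hv
    have h := hmin (Setoid.ker fun v => ∃ i : ℤ, (T ^ i) u = v) ?_ ?_ hv
    · have h' : (∃ i : ℤ, (T ^ i) u = v) = ∃ i : ℤ, (T ^ i) u = u := h
      rw [h']
      exact ⟨0, rfl⟩
    · have aux : ∀ v, (∃ i : ℤ, (T ^ i) u = v) → ∃ i : ℤ, (T ^ i) u = A v := by
        rintro _ ⟨i, rfl⟩
        exact ⟨1 - i, (hPT i).symm⟩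
      intro v
      exact propext ⟨fun h => by simpa [hA v] using aux _ h, aux v⟩
    · have aux : ∀ v, (∃ i : ℤ, (T ^ i) u = v) → ∃ i : ℤ, (T ^ i) u = B v := by
        rintro _ ⟨i, rfl⟩
        exact ⟨-i, (hQT i).symm⟩
      intro v
      exact propext ⟨fun h => by simpa [hB v] using aux _ h, aux v⟩
  obtain ⟨N, hN0, hN⟩ : ∃ N : ℤ, 0 < N ∧ ∀ i : ℤ, (T ^ i) u = u ↔ N ∣ i := by
    refine ⟨(Function.minimalPeriod (T • ·) u : ℤ), ?_, fun i => ?_⟩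
    · have hper : u ∈ Function.periodicPts (T • · : V → V) := by
        refine ⟨orderOf T, orderOf_pos T, ?_⟩
        have : T ^ orderOf T • u = u := by rw [pow_orderOf_eq_one, one_smul]
        rw [Function.IsPeriodicPt, Function.IsFixedPt, smul_iterate]
        exact this
      exact_mod_cast Function.minimalPeriod_pos_of_mem_periodicPts hper
    · rw [← MulAction.zpow_smul_eq_iff_minimalPeriod_dvd]
      rfl
  have hNN : ∀ i j : ℤ, (T ^ i) u = (T ^ j) u ↔ N ∣ i - j := by
    intro i j
    rw [← hN, sub_eq_neg_add, zpow_add, zpow_neg, Equiv.Perm.mul_apply,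
      Equiv.Perm.inv_eq_iff_eq]
  have hN1 : ¬ N ∣ 1 := by
    rw [← hN, zpow_one]
    intro h
    apply hu'
    have : T u = A u := by
      change A (B u) = A u
      rw [hu]
    rw [← this, h]
  have hBfix : ∀ i : ℤ, B ((T ^ i) u) = (T ^ i) u ↔ N ∣ 2 * i := by
    intro i
    rw [hQT, hNN, ← Int.dvd_neg]
    ring_nf
  have hAfix : ∀ i : ℤ, A ((T ^ i) u) = (T ^ i) u ↔ N ∣ 2 * i - 1 := by
    intro i
    rw [hPT, hNN, ← Int.dvd_neg]
    ring_nf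
  have hne : ∀ i : ℤ, (T ^ i) u ≠ u ↔ ¬ N ∣ i := fun i => not_congr (hN i)
  rcases Int.even_or_odd' N with ⟨M, hM | hM⟩
  · refine ⟨(T ^ M) u, ⟨⟨(hne M).2 ?_, hTi M⟩, Or.inr ((hBfix M).2 (by rw [hM]))⟩, ?_⟩
    · intro h
      have := Int.le_of_dvd (by omega) h
      omega
    · rintro v ⟨⟨hv, hvr⟩, hv'⟩
      obtain ⟨i, rfl⟩ := hr v hvr
      rw [hNN]
      rw [hne] at hv
      rcases hv' with h | h
      · rw [hAfix] at h
        obtain ⟨c, hc⟩ := h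
        rw [hM] at hc
        have : 2 * (M * c) = 2 * i - 1 := by rw [hc]; ring
        omega
      · rw [hBfix] at h
        obtain ⟨c, hc⟩ := h
        rw [hM] at hc
        have hi : i = M * c := by linarith
        rcases Int.even_or_odd' c with ⟨d, hd | hd⟩
        · exact absurd ⟨d, by rw [hi, hM, hd]; ring⟩ hv
        · exact ⟨d, by rw [hi, hM, hd]; ring⟩
  · refine ⟨(T ^ (M + 1)) u, ⟨⟨(hne _).2 ?_, hTi _⟩, Or.inl ((hAfix _).2 ⟨1, by rw [hM]; ring⟩)⟩, ?_⟩
    · intro h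
      have h1 := Int.le_of_dvd (by omega) h
      have : N = 1 := by omega
      exact hN1 (by rw [this])
    · rintro v ⟨⟨hv, hvr⟩, hv'⟩
      obtain ⟨i, rfl⟩ := hr v hvr
      rw [hNN]
      rw [hne] at hv
      have hcop : IsCoprime N 2 := ⟨1, -M, by rw [hM]; ring⟩
      rcases hv' with h | h
      · rw [hAfix] at h
        apply hcop.dvd_of_dvd_mul_left
        have e : 2 * (i - (M + 1)) = (2 * i - 1) - N := by rw [hM]; ring
        rw [e]
        exact dvd_sub h (dvd_refl N)
      · rw [hBfix] at h
        exact absurd (hcop.dvd_of_dvd_mul_left h) hv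

theorem IsBrauer.comp [Finite X] [Finite Y] [Finite Z] {α : Setoid (X ⊕ Y)} {β : Setoid (Y ⊕ Z)}
    (hα : IsBrauer α) (hβ : IsBrauer β) : IsBrauer (comp α β) := by
  obtain ⟨f, hf, hf', hfα⟩ := hα.exists_involutive
  obtain ⟨g, hg, hg', hgβ⟩ := hβ.exists_involutive
  let A : X ⊕ (Y ⊕ Z) → X ⊕ (Y ⊕ Z) :=
    Sum.elim (fun x => upperPart (f (Sum.inl x)))
      (Sum.elim (fun y => upperPart (f (Sum.inr y))) fun z => Sum.inr (Sum.inr z))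
  let B : X ⊕ (Y ⊕ Z) → X ⊕ (Y ⊕ Z) := Sum.map id g
  have hAu : ∀ p, A (upperPart p) = upperPart (f p) := by rintro (x | y) <;> rfl
  have hAz : ∀ z, A (Sum.inr (Sum.inr z)) = Sum.inr (Sum.inr z) := fun _ => rfl
  have hinj : Function.Injective (upperPart : X ⊕ Y → X ⊕ (Y ⊕ Z)) :=
    Sum.map_injective.2 ⟨fun _ _ h => h, Sum.inl_injective⟩
  have hA : Function.Involutive A := by
    rintro (x | y | z)
    · change A (upperPart (f (Sum.inl x))) = _
      rw [hAu, hf]; rfl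
    · change A (upperPart (f (Sum.inr y))) = _
      rw [hAu, hf]; rfl
    · rfl
  have hB : Function.Involutive B := by
    rintro (x | t)
    · rfl
    · change Sum.inr (g (g t)) = _
      rw [hg]
  have hAne : ∀ p : X ⊕ Y, A (upperPart p) ≠ upperPart p := by
    intro p h
    rw [hAu] at h
    exact hf' p (hinj h)
  have hBne : ∀ t : Y ⊕ Z, B (Sum.inr t) ≠ Sum.inr t := fun t h =>
    hg' t (Sum.inr_injective h)
  let r : Setoid (X ⊕ (Y ⊕ Z)) := Setoid.map α upperPart ⊔ Setoid.map β lowerPart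
  have hrA : ∀ v, r (A v) v := by
    have aux : ∀ p, r (A (upperPart p)) (upperPart p) := by
      intro p
      rw [hAu]
      exact (le_sup_left : Setoid.map α upperPart ≤ r)
        (Setoid.le_comap_map (α.symm' ((hfα _ _).2 (Or.inr rfl))))
    rintro (x | y | z)
    · exact aux (Sum.inl x)
    · exact aux (Sum.inr y)
    · exact r.refl' _
  have hrB : ∀ v, r (B v) v := by
    rintro (x | t)
    · exact r.refl' _
    · exact (le_sup_right : Setoid.map β lowerPart ≤ r)
        (Setoid.le_comap_map (f := lowerPart) (β.symm' ((hgβ _ _).2 (Or.inr rfl))))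
  have hmin : ∀ s : Setoid (X ⊕ (Y ⊕ Z)), (∀ v, s (A v) v) → (∀ v, s (B v) v) → r ≤ s := by
    intro s hsA hsB
    refine sup_le (map_le_iff.2 ?_) (map_le_iff.2 ?_)
    · intro p q hpq
      rcases (hfα p q).1 hpq with rfl | rfl
      · exact s.refl' _
      · have := hsA (upperPart p)
        rw [hAu] at this
        exact s.symm' this
    · intro p q hpq
      rcases (hgβ p q).1 hpq with rfl | rfl
      · exact s.refl' _
      · exact s.symm' (hsB (Sum.inr p))
  have hout : ∀ v : X ⊕ (Y ⊕ Z), (A v = v ∨ B v = v) ↔ ∃ p : X ⊕ Z, outerPart p = v := by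
    rintro (x | y | z)
    · exact iff_of_true (Or.inr rfl) ⟨Sum.inl x, rfl⟩
    · refine iff_of_false ?_ ?_
      · rintro (h | h)
        · exact hAne (Sum.inr y) h
        · exact hBne _ h
      · rintro ⟨p | p, hp⟩ <;> simp [outerPart] at hp
    · exact iff_of_true (Or.inl rfl) ⟨Sum.inr z, rfl⟩
  have hoinj : Function.Injective (outerPart : X ⊕ Z → X ⊕ (Y ⊕ Z)) :=
    Sum.map_injective.2 ⟨fun _ _ h => h, Sum.inr_injective⟩
  rw [isBrauer_iff_existsUnique]
  intro p
  have key : ∃! v, (v ≠ outerPart p ∧ r v (outerPart p)) ∧ (A v = v ∨ B v = v) := by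
    rcases p with x | z
    · exact existsUnique_other_end hA hB hrA hrB hmin rfl (hAne (Sum.inl x))
    · have := existsUnique_other_end hB hA hrB hrA (fun s h₁ h₂ => hmin s h₂ h₁)
        (hAz z) (hBne (Sum.inr z))
      simp only [or_comm (a := B _ = _)] at this
      exact this
  obtain ⟨v, ⟨⟨hv, hvr⟩, hv'⟩, huniq⟩ := key
  obtain ⟨q, rfl⟩ := (hout v).1 hv'
  refine ⟨q, ⟨fun h => hv (by rw [h]), hvr⟩, ?_⟩
  rintro q' ⟨h₁, h₂⟩
  exact hoinj (huniq _ ⟨⟨fun h => h₁ (hoinj h), h₂⟩, (hout _).2 ⟨q', rfl⟩⟩)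

end Diagram

/-! ## The Brauer category -/

/-- The objects of the Brauer category: the natural numbers `0, 1, 2, …`. -/
structure BrauerCat where
  /-- The number of vertices. -/
  size : ℕ

namespace BrauerCat

/-- The set `ℬ_{mn}` of Brauer partitions of `[m] ∪ [n]'`. -/
def Hom (m n : ℕ) : Type := {α : Setoid (Fin m ⊕ Fin n) // Diagram.IsBrauer α}

/-- The Brauer category `ℬ`; its morphisms are composed from left to right, `α ≫ β` being the
product `αβ` of `α` and `β`. -/
instance instCategory : Category BrauerCat where
  Hom X Y := Hom X.size Y.size
  id X := ⟨Diagram.idPartition (Fin X.size), Diagram.isBrauer_idPartition _⟩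
  comp α β := ⟨Diagram.comp α.1 β.1, α.2.comp β.2⟩
  id_comp α := Subtype.ext (Diagram.id_comp α.1)
  comp_id α := Subtype.ext (Diagram.comp_id α.1)
  assoc α β γ := Subtype.ext (Diagram.comp_assoc α.1 β.1 γ.1)

/-- The rank of a Brauer partition: its number of transversals. -/
noncomputable def rank {X Y : BrauerCat} (α : X ⟶ Y) : ℕ := Diagram.rank α.1

end BrauerCat

/-! ## Sandwich semigroups -/

/-- The underlying set of the sandwich semigroup of a morphism `a : Y ⟶ X`: the
hom-set from `X` to `Y`. -/
def Sandwich {C : Type*} [Category C] {X Y : C} (_a : Y ⟶ X) : Type _ := X ⟶ Y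

/-- The sandwich product `f ⋆ g = f a g`. -/
instance instSemigroupSandwich {C : Type*} [Category C] {X Y : C} (a : Y ⟶ X) :
    Semigroup (Sandwich a) where
  mul f g := ((f : X ⟶ Y) ≫ a ≫ (g : X ⟶ Y) : X ⟶ Y)
  mul_assoc := by
    have h : ∀ f g h : X ⟶ Y, (f ≫ a ≫ g) ≫ a ≫ h = f ≫ a ≫ (g ≫ a ≫ h) := by simp
    exact h

/-! The invariants that separate the semigroups come from counting. Let `E` be the object 0 or 1
with the parity of `m`; its only endomorphism is the identity. Therefore the elements `x` with `x *
y * x = x` for all `y` are exactly the morphisms that factor through `E`, and they form a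
rectangular band with coordinates in Hom(m, E) and Hom(E, n) (`Sandwich.exists_factor`,
`Sandwich.factor_mul_factor`). An isomorphism preserves the sizes of these two hom-sets and of the
whole semigroup. All three are numbers of perfect matchings, on m + (m mod 2), n + (n mod 2) and m +
n points. The number of perfect matchings of an even set grows strictly from two points on, but 0
and 2 points both give 1; this coincidence is the source of all exceptional cases. Arithmetic
(`eq_or_swap_of_add_eq`) leaves equal sizes, totals of at most 2, and the sizes in (iii) and (iv),
where the ranks are forced because a row of at most one vertex leaves no choice.

For equal sizes the rank is recovered from the number of products: a morphism is a product in the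
sandwich semigroup if and only if its rank is at most that of the sandwich element
(`exists_mul_eq_iff`). This rests on rank being monotone under composition and on the factorization
`IsBrauer.exists_eq_comp`.

Conversely, sandwich elements of equal size and rank differ by a relabelling of vertices
(`IsBrauer.exists_comap_eq`), which induces an isomorphism. If n ≤ 1 every product equals its left
factor, and if m ≤ 1 its right factor; then only the cardinality matters, and it depends on m + n
alone. -/

/-! ## Perfect matchings -/

/-- The perfect matchings of a set, encoded as involutions without fixed points. -/
def PerfectMatching (V : Type*) : Type _ :=
  {f : V → V // Function.Involutive f ∧ ∀ v, f v ≠ v}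

namespace PerfectMatching

variable {V W : Type*}

instance [Finite V] : Finite (PerfectMatching V) := by
  unfold PerfectMatching
  infer_instance

/-- Transport of perfect matchings along a bijection. -/
def congr (e : V ≃ W) : PerfectMatching V ≃ PerfectMatching W where
  toFun f := ⟨fun w => e (f.1 (e.symm w)), fun w => by simp [f.2.1 _], fun w h =>
    f.2.2 (e.symm w) (e.injective (h.trans (e.apply_symm_apply w).symm))⟩
  invFun f := ⟨fun v => e.symm (f.1 (e v)), fun v => by simp [f.2.1 _], fun v h =>
    f.2.2 (e v) (e.symm.injective (h.trans (e.symm_apply_apply v).symm))⟩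
  left_inv f := Subtype.ext (funext fun v => by simp)
  right_inv f := Subtype.ext (funext fun v => by simp)

theorem even_card [Finite V] (f : PerfectMatching V) : Even (Nat.card V) := by
  classical
  have := Fintype.ofFinite V
  have h2 : f.2.1.toPerm ^ 2 = 1 := Equiv.ext fun v => f.2.1 v
  have hs : f.2.1.toPerm.support = Finset.univ := by
    ext v
    simpa using f.2.2 v
  have := Equiv.Perm.two_dvd_card_support h2
  rw [hs, Finset.card_univ, ← Nat.card_eq_fintype_card] at this
  exact even_iff_two_dvd.2 this

theorem nonempty_of_even [Finite V] (h : Even (Nat.card V)) : Nonempty (PerfectMatching V) := by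
  obtain ⟨j, hj⟩ := h
  obtain ⟨e⟩ : Nonempty (Fin j × Bool ≃ V) := Finite.card_eq.1 (by simp [hj, mul_two])
  exact ⟨congr e ⟨fun p => (p.1, !p.2), fun p => by simp, fun p => by simp [Prod.ext_iff]⟩⟩

/-- The points related by `r` are matched among themselves, so their number is even. Evenly many
points remain, and any perfect matching of these completes `r`. -/
theorem exists_extend [Finite V] (hV : Even (Nat.card V)) (r : V → V → Prop)
    (hsymm : ∀ x y, r x y → r y x) (hirrefl : ∀ x, ¬ r x x)
    (hfun : ∀ x y z, r x y → r x z → y = z) :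
    ∃ f : PerfectMatching V, ∀ x y, r x y → f.1 x = y := by
  classical
  let S : Set V := {x | ∃ y, r x y}
  have hS : ∀ x : S, ∃ y : S, r x y := fun ⟨x, y, hxy⟩ => ⟨⟨y, x, hsymm _ _ hxy⟩, hxy⟩
  choose p hp using hS
  have hpi : Function.Involutive p := fun x =>
    Subtype.ext (hfun _ _ _ (hp (p x)) (hsymm _ _ (hp x)))
  have hpf : ∀ x, p x ≠ x := fun x h => hirrefl x (by simpa [h] using hp x)
  have hSe : Even (Nat.card S) := even_card ⟨p, hpi, hpf⟩
  have hc : Nat.card S + Nat.card (Sᶜ : Set V) = Nat.card V := by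
    rw [← Nat.card_sum]
    exact Nat.card_congr (Equiv.Set.sumCompl S)
  have hSc : Even (Nat.card (Sᶜ : Set V)) := by
    rw [← hc, Nat.even_add] at hV
    exact hV.1 hSe
  obtain ⟨q⟩ := nonempty_of_even hSc
  refine ⟨congr (Equiv.Set.sumCompl S) ⟨Sum.map p q.1, ?_, ?_⟩, fun x y hxy => ?_⟩
  · rintro (x | x)
    · simp [hpi x]
    · simp [q.2.1 x]
  · rintro (x | x) h
    · exact hpf x (Sum.inl_injective h)
    · exact q.2.2 x (Sum.inr_injective h)
  · have hx : x ∈ S := ⟨y, hxy⟩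
    change Equiv.Set.sumCompl S (Sum.map p q.1 ((Equiv.Set.sumCompl S).symm x)) = y
    rw [Equiv.Set.sumCompl_symm_apply_of_mem hx]
    exact hfun _ _ _ (hp ⟨x, hx⟩) hxy

/-- Adding a disjoint pair to a perfect matching. -/
def addPair (f : PerfectMatching V) : PerfectMatching (V ⊕ Bool) :=
  ⟨Sum.map f.1 not, by rintro (x | x) <;> simp [f.2.1 _], by
    rintro (x | x) h
    · exact f.2.2 x (Sum.inl_injective h)
    · simp at h⟩

theorem addPair_injective : Function.Injective (addPair (V := V)) := by
  intro f g h
  refine Subtype.ext (funext fun v => ?_)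
  exact Sum.inl_injective (congrFun (congrArg Subtype.val h) (Sum.inl v))

theorem card_lt_card_sum_bool [Finite V] [Nonempty V] (hV : Even (Nat.card V)) :
    Nat.card (PerfectMatching V) < Nat.card (PerfectMatching (V ⊕ Bool)) := by
  classical
  have := Fintype.ofFinite (PerfectMatching V)
  have := Fintype.ofFinite (PerfectMatching (V ⊕ Bool))
  rw [Nat.card_eq_fintype_card, Nat.card_eq_fintype_card]
  obtain ⟨f⟩ := nonempty_of_even hV
  obtain ⟨v⟩ := ‹Nonempty V›
  -- Exchanging an old point `v` with one of the two new points gives a matching that does not pair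
  -- the new points with each other, hence lies outside the image of `addPair`.
  refine Fintype.card_lt_of_injective_of_notMem _ addPair_injective
    (b := congr (Equiv.swap (Sum.inl v) (Sum.inr true)) f.addPair) ?_
  rintro ⟨g, hg⟩
  have h : Sum.inr true = Equiv.swap (Sum.inl v) (Sum.inr true)
      (f.addPair.1 ((Equiv.swap (Sum.inl v) (Sum.inr true)).symm (Sum.inr false))) :=
    congrFun (congrArg Subtype.val hg) (Sum.inr false)
  rw [Equiv.symm_swap, Equiv.swap_apply_of_ne_of_ne (x := Sum.inr false) (by simp) (by simp)] at h
  exact Sum.inr_ne_inl (h.trans (Equiv.swap_apply_right _ _))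

theorem card_congr_of_card_eq [Finite V] [Finite W] (h : Nat.card V = Nat.card W) :
    Nat.card (PerfectMatching V) = Nat.card (PerfectMatching W) :=
  Nat.card_congr (congr (Finite.card_eq.1 h).some)

theorem subsingleton_of_card_le_two [Finite V] (h : Nat.card V ≤ 2) :
    Subsingleton (PerfectMatching V) := by
  refine ⟨fun f g => Subtype.ext (funext fun v => ?_)⟩
  by_contra hne
  have hinj : Function.Injective ![v, f.1 v, g.1 v] := by
    intro i j
    fin_cases i <;> fin_cases j <;> simp [f.2.2 v, g.2.2 v, (f.2.2 v).symm, (g.2.2 v).symm, hne,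
      Ne.symm hne]
  have := Nat.card_le_card_of_injective _ hinj
  simp at this
  omega

theorem card_eq_one [Finite V] (h : Nat.card V ≤ 2) (hV : Even (Nat.card V)) :
    Nat.card (PerfectMatching V) = 1 :=
  Nat.card_eq_one_iff_unique.2 ⟨subsingleton_of_card_le_two h, nonempty_of_even hV⟩

/-- The sequence starts at two points because 0 and 2 points have the same number of matchings,
namely one. -/
theorem strictMono_card :
    StrictMono fun j : ℕ => Nat.card (PerfectMatching (Fin (2 * j + 2))) := by
  refine strictMono_nat_of_lt_succ fun j => ?_
  refine (card_lt_card_sum_bool (by simp; exact ⟨j + 1, by ring⟩)).trans_eq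
    (card_congr_of_card_eq ?_)
  simp
  ring

theorem card_eq_card_fin [Finite V] {j : ℕ} (hV : Even (Nat.card V))
    (h : Nat.card V = 2 * j + 2 ∨ Nat.card V = 0 ∧ j = 0) :
    Nat.card (PerfectMatching V) = Nat.card (PerfectMatching (Fin (2 * j + 2))) := by
  rcases h with h | ⟨h, rfl⟩
  · exact card_congr_of_card_eq (by simpa using h)
  · rw [card_eq_one (by omega) hV, card_eq_one (by simp) (by simp)]

theorem eq_or_le_two_of_card_eq [Finite V] [Finite W] (hV : Even (Nat.card V))
    (hW : Even (Nat.card W))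
    (h : Nat.card (PerfectMatching V) = Nat.card (PerfectMatching W)) :
    Nat.card V = Nat.card W ∨ (Nat.card V ≤ 2 ∧ Nat.card W ≤ 2) := by
  -- The sizes 0 and 2 share the index 0, so equal indices mean equal sizes or two sizes at most 2.
  have key : ∀ a : ℕ, Even a → ∃ j, (a = 2 * j + 2 ∨ a = 0 ∧ j = 0) := by
    rintro a ⟨j, rfl⟩
    rcases j with _ | j
    · exact ⟨0, by simp⟩
    · exact ⟨j, by omega⟩
  obtain ⟨i, hi⟩ := key _ hV
  obtain ⟨j, hj⟩ := key _ hW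
  rw [card_eq_card_fin hV hi, card_eq_card_fin hW hj] at h
  have := strictMono_card.injective h
  omega

end PerfectMatching

/-! ### Conjugacy of involutions -/

/-- Two involutions of a finite set with the same number of fixed points are conjugate. -/
theorem Function.Involutive.exists_conj {V : Type*} [Finite V] {f g : V → V}
    (hf : Function.Involutive f) (hg : Function.Involutive g)
    (h : Nat.card (Function.fixedPoints f) = Nat.card (Function.fixedPoints g)) :
    ∃ e : V ≃ V, ∀ v, e (f v) = g (e v) := by
  classical
  have := Fintype.ofFinite V
  -- All nontrivial cycles have length 2, so the cycle type is determined by the number of moved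
  -- points.
  have hc : hf.toPerm.cycleType = hg.toPerm.cycleType := by
    have hf2 : hf.toPerm ^ 2 = 1 := Equiv.ext fun v => hf v
    have hg2 : hg.toPerm ^ 2 = 1 := Equiv.ext fun v => hg v
    have ef := Equiv.Perm.cycleType_of_pow_prime_eq_one (p := 2) hf2
    have eg := Equiv.Perm.cycleType_of_pow_prime_eq_one (p := 2) hg2
    have cf := Equiv.Perm.card_fixedPoints hf.toPerm
    have cg := Equiv.Perm.card_fixedPoints hg.toPerm
    rw [← Nat.card_eq_fintype_card] at cf cg
    have h' : Nat.card (Function.fixedPoints hf.toPerm) =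
      Nat.card (Function.fixedPoints hg.toPerm) := h
    -- The number of fixed points is given by a truncated subtraction; these bounds make it exact.
    have lf := hf.toPerm.sum_cycleType_le
    have lg := hg.toPerm.sum_cycleType_le
    generalize hf.toPerm.cycleType = cycf at *
    generalize hg.toPerm.cycleType = cycg at *
    have sf := congrArg Multiset.sum ef
    have sg := congrArg Multiset.sum eg
    rw [Multiset.sum_replicate, smul_eq_mul] at sf sg
    rw [ef, eg, show cycf.card = cycg.card by omega]
  obtain ⟨c, hc⟩ := isConj_iff.1 (Equiv.Perm.isConj_iff_cycleType_eq.2 hc)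
  refine ⟨c, fun v => ?_⟩
  have := congrArg (fun p : Equiv.Perm V => p (c v)) hc
  simpa using this

/-! ## Sandwich semigroups and trivial objects -/

namespace Sandwich

variable {C : Type*} [Category C] {X Y : C}

/-- A morphism as an element of a sandwich semigroup. -/
def of (a : Y ⟶ X) : (X ⟶ Y) ≃ Sandwich a := Equiv.refl _

theorem of_mul_of (a : Y ⟶ X) (f g : X ⟶ Y) : of a f * of a g = of a (f ≫ a ≫ g) := rfl

theorem exists_of {a : Y ⟶ X} (x : Sandwich a) : ∃ f, of a f = x := (of a).surjective x

theorem mul_eq_left [Subsingleton (Y ⟶ Y)] {a : Y ⟶ X} (x y : Sandwich a) : x * y = x := by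
  obtain ⟨f, rfl⟩ := exists_of x
  obtain ⟨g, rfl⟩ := exists_of y
  rw [of_mul_of, Subsingleton.elim (a ≫ g) (𝟙 Y), Category.comp_id]

theorem mul_eq_right [Subsingleton (X ⟶ X)] {a : Y ⟶ X} (x y : Sandwich a) : x * y = y := by
  obtain ⟨f, rfl⟩ := exists_of x
  obtain ⟨g, rfl⟩ := exists_of y
  rw [of_mul_of, ← Category.assoc, Subsingleton.elim (f ≫ a) (𝟙 X), Category.id_comp]

/-- Putting `y = u₀ ≫ v₀` into the hypothesis displays `x` as a composite through `E`. -/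
theorem exists_factor {E : C} {a : Y ⟶ X} (u₀ : X ⟶ E) (v₀ : E ⟶ Y) {x : Sandwich a}
    (hx : ∀ y, x * y * x = x) : ∃ (u : X ⟶ E) (v : E ⟶ Y), of a (u ≫ v) = x := by
  obtain ⟨f, rfl⟩ := exists_of x
  refine ⟨f ≫ a ≫ u₀, v₀ ≫ a ≫ f, ?_⟩
  rw [← hx (of a (u₀ ≫ v₀)), of_mul_of, of_mul_of]
  simp only [Category.assoc]

section

variable {E : C} [Subsingleton (E ⟶ E)] {a : Y ⟶ X}

/-- The inner composite `v ≫ a ≫ u'` is an endomorphism of `E`, hence trivial. This is the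
multiplication of a rectangular band. -/
theorem factor_mul_factor (u u' : X ⟶ E) (v v' : E ⟶ Y) :
    of a (u ≫ v) * of a (u' ≫ v') = of a (u ≫ v') := by
  have h : v ≫ a ≫ u' = 𝟙 E := Subsingleton.elim _ _
  have : (u ≫ v) ≫ a ≫ u' ≫ v' = u ≫ (v ≫ a ≫ u') ≫ v' := by simp only [Category.assoc]
  rw [of_mul_of, this, h, Category.id_comp]

theorem factor_mul_mul (u : X ⟶ E) (v : E ⟶ Y) (y : Sandwich a) :
    of a (u ≫ v) * y * of a (u ≫ v) = of a (u ≫ v) := by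
  obtain ⟨g, rfl⟩ := exists_of y
  rw [of_mul_of, Category.assoc, factor_mul_factor]

/-- Within the rectangular band, `x * y = y` says that `y` has the same first factor `u` as `x`. The
second factor is then determined by `y`, because `v ≫ a` cancels `u` from the left. -/
theorem card_right_ideal (u₀ : X ⟶ E) (v₀ : E ⟶ Y) {x : Sandwich a} (hx : ∀ y, x * y * x = x) :
    Nat.card {y : Sandwich a // (∀ z, y * z * y = y) ∧ x * y = y} = Nat.card (E ⟶ Y) := by
  obtain ⟨u, v, rfl⟩ := exists_factor u₀ v₀ hx
  refine (Nat.card_congr (Equiv.ofBijective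
    (fun w : E ⟶ Y => ⟨of a (u ≫ w), factor_mul_mul u w, factor_mul_factor u u v w⟩)
    ⟨fun w w' h => ?_, ?_⟩)).symm
  · have h' : u ≫ w = u ≫ w' := (of a).injective (congrArg Subtype.val h)
    have e : (v ≫ a) ≫ u = 𝟙 E := Subsingleton.elim _ _
    rw [← Category.id_comp w, ← Category.id_comp w', ← e]
    simp only [Category.assoc, h']
  · rintro ⟨y, hy, hxy⟩
    obtain ⟨u', v', rfl⟩ := exists_factor u₀ v₀ hy
    rw [factor_mul_factor] at hxy
    exact ⟨v', Subtype.ext hxy⟩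

theorem card_left_ideal (u₀ : X ⟶ E) (v₀ : E ⟶ Y) {x : Sandwich a} (hx : ∀ y, x * y * x = x) :
    Nat.card {y : Sandwich a // (∀ z, y * z * y = y) ∧ y * x = y} = Nat.card (X ⟶ E) := by
  obtain ⟨u, v, rfl⟩ := exists_factor u₀ v₀ hx
  refine (Nat.card_congr (Equiv.ofBijective
    (fun w : X ⟶ E => ⟨of a (w ≫ v), factor_mul_mul w v, factor_mul_factor w u v v⟩)
    ⟨fun w w' h => ?_, ?_⟩)).symm
  · have h' : w ≫ v = w' ≫ v := (of a).injective (congrArg Subtype.val h)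
    have e : v ≫ a ≫ u = 𝟙 E := Subsingleton.elim _ _
    rw [← Category.comp_id w, ← Category.comp_id w', ← e, ← Category.assoc, h', Category.assoc]
  · rintro ⟨y, hy, hxy⟩
    obtain ⟨u', v', rfl⟩ := exists_factor u₀ v₀ hy
    rw [factor_mul_factor] at hxy
    exact ⟨u', Subtype.ext hxy⟩

end

/-- An isomorphism of sandwich semigroups preserves the numbers of morphisms to and from objects
with trivial endomorphism monoids. -/
theorem card_eq_of_mulEquiv {X' Y' E E' : C} [Subsingleton (E ⟶ E)] [Subsingleton (E' ⟶ E')]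
    {a : Y ⟶ X} {b : Y' ⟶ X'} (φ : Sandwich a ≃* Sandwich b) (u : X ⟶ E) (v : E ⟶ Y)
    (u' : X' ⟶ E') (v' : E' ⟶ Y') :
    Nat.card (X ⟶ E) = Nat.card (X' ⟶ E') ∧ Nat.card (E ⟶ Y) = Nat.card (E' ⟶ Y') := by
  let x : Sandwich a := of a (u ≫ v)
  have hx : ∀ y, x * y * x = x := factor_mul_mul u v
  -- Membership in the rectangular band is expressed by multiplication alone, so `φ` respects it.
  have hφ : ∀ w, (∀ y, w * y * w = w) ↔ ∀ y, φ w * y * φ w = φ w := fun w => by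
    rw [φ.surjective.forall]
    simp only [← map_mul, φ.injective.eq_iff]
  constructor
  · rw [← card_left_ideal u v hx, ← card_left_ideal u' v' ((hφ x).1 hx)]
    refine Nat.card_congr (φ.toEquiv.subtypeEquiv fun y => ?_)
    refine and_congr (hφ y) ?_
    change _ ↔ φ y * φ x = φ y
    rw [← map_mul, φ.injective.eq_iff]
  · rw [← card_right_ideal u v hx, ← card_right_ideal u' v' ((hφ x).1 hx)]
    refine Nat.card_congr (φ.toEquiv.subtypeEquiv fun y => ?_)
    refine and_congr (hφ y) ?_
    change _ ↔ φ x * φ y = φ y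
    rw [← map_mul, φ.injective.eq_iff]

/-- Both semigroups are left zero semigroups, so any bijection is an isomorphism. -/
theorem nonempty_mulEquiv_of_left {X' Y' : C} [Subsingleton (Y ⟶ Y)] [Subsingleton (Y' ⟶ Y')]
    (a : Y ⟶ X) (b : Y' ⟶ X') (h : Nonempty ((X ⟶ Y) ≃ (X' ⟶ Y'))) :
    Nonempty (Sandwich a ≃* Sandwich b) := by
  obtain ⟨e⟩ := h
  let e' : Sandwich a ≃ Sandwich b := (of a).symm.trans (e.trans (of b))
  exact ⟨⟨e', fun f g => by
    change e' (f * g) = e' f * e' g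
    rw [mul_eq_left, mul_eq_left]⟩⟩

theorem nonempty_mulEquiv_of_right {X' Y' : C} [Subsingleton (X ⟶ X)] [Subsingleton (X' ⟶ X')]
    (a : Y ⟶ X) (b : Y' ⟶ X') (h : Nonempty ((X ⟶ Y) ≃ (X' ⟶ Y'))) :
    Nonempty (Sandwich a ≃* Sandwich b) := by
  obtain ⟨e⟩ := h
  let e' : Sandwich a ≃ Sandwich b := (of a).symm.trans (e.trans (of b))
  exact ⟨⟨e', fun f g => by
    change e' (f * g) = e' f * e' g
    rw [mul_eq_right, mul_eq_right]⟩⟩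

end Sandwich

/-! ## Brauer partitions and perfect matchings -/

namespace Diagram

variable {X Y Z W : Type*}

/-- The partition into the pairs of a perfect matching. -/
def ofMatching (f : PerfectMatching (X ⊕ Y)) : Setoid (X ⊕ Y) where
  r u v := v = u ∨ v = f.1 u
  iseqv :=
    { refl := fun _ => Or.inl rfl
      symm := by
        rintro u v (rfl | rfl)
        · exact Or.inl rfl
        · exact Or.inr (f.2.1 u).symm
      trans := by
        rintro u v w (rfl | rfl) (rfl | rfl)
        · exact Or.inl rfl
        · exact Or.inr rfl
        · exact Or.inr rfl
        · exact Or.inl (f.2.1 u) }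

theorem ofMatching_iff (f : PerfectMatching (X ⊕ Y)) (u v : X ⊕ Y) :
    ofMatching f u v ↔ v = u ∨ v = f.1 u := Iff.rfl

theorem isBrauer_ofMatching (f : PerfectMatching (X ⊕ Y)) : IsBrauer (ofMatching f) := by
  rw [isBrauer_iff_existsUnique]
  refine fun u => ⟨f.1 u, ⟨f.2.2 u, Setoid.symm' _ (Or.inr rfl)⟩, ?_⟩
  rintro v ⟨hv, h⟩
  exact ((ofMatching f).symm' h).resolve_left hv

theorem ofMatching_bijective : Function.Bijective
    (fun f : PerfectMatching (X ⊕ Y) =>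
      (⟨ofMatching f, isBrauer_ofMatching f⟩ : {α : Setoid (X ⊕ Y) // IsBrauer α})) := by
  constructor
  · intro f g h
    refine Subtype.ext (funext fun u => ?_)
    have h' : ofMatching f = ofMatching g := congrArg Subtype.val h
    have : ofMatching g u (f.1 u) := h' ▸ Or.inr rfl
    exact this.resolve_left (f.2.2 u)
  · rintro ⟨α, hα⟩
    obtain ⟨f, h₁, h₂, h₃⟩ := hα.exists_involutive
    exact ⟨⟨f, h₁, h₂⟩, Subtype.ext (Setoid.ext fun u v => (h₃ u v).symm)⟩

/-- Brauer partitions are perfect matchings. -/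
noncomputable def matchingEquiv (X Y : Type*) :
    PerfectMatching (X ⊕ Y) ≃ {α : Setoid (X ⊕ Y) // IsBrauer α} :=
  Equiv.ofBijective _ ofMatching_bijective

theorem IsBrauer.exists_matching {α : Setoid (X ⊕ Y)} (h : IsBrauer α) :
    ∃ f : PerfectMatching (X ⊕ Y), ofMatching f = α := by
  obtain ⟨f, hf⟩ := ofMatching_bijective.2 ⟨α, h⟩
  exact ⟨f, congrArg Subtype.val hf⟩

theorem IsBrauer.eq_of_rel {α : Setoid (X ⊕ Y)} (h : IsBrauer α) {u v w : X ⊕ Y} (hv : α u v)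
    (hw : α u w) (hvu : v ≠ u) (hwu : w ≠ u) : v = w :=
  ((isBrauer_iff_existsUnique α).1 h u).unique ⟨hvu, α.symm' hv⟩ ⟨hwu, α.symm' hw⟩

/-- Because Brauer partitions form an antichain, each later identity between them needs only one
inclusion. -/
theorem IsBrauer.eq_of_le {α β : Setoid (X ⊕ Y)} (hα : IsBrauer α) (hβ : IsBrauer β)
    (h : α ≤ β) : α = β := by
  obtain ⟨f, rfl⟩ := hα.exists_matching
  refine le_antisymm h fun u v huv => ?_
  by_cases hvu : v = u
  · exact Or.inl hvu
  · exact Or.inr (hβ.eq_of_rel huv (h (Or.inr rfl)) hvu (f.2.2 u))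

end Diagram

namespace BrauerCat

/-- The morphisms of the Brauer category are perfect matchings. -/
noncomputable def homEquiv (m n : ℕ) :
    PerfectMatching (Fin m ⊕ Fin n) ≃ (BrauerCat.mk m ⟶ BrauerCat.mk n) :=
  Diagram.matchingEquiv (Fin m) (Fin n)

instance (m n : ℕ) : Finite (BrauerCat.mk m ⟶ BrauerCat.mk n) :=
  Finite.of_equiv _ (homEquiv m n)

theorem nonempty_hom {m n : ℕ} (h : Even (m + n)) :
    Nonempty (BrauerCat.mk m ⟶ BrauerCat.mk n) :=
  (PerfectMatching.nonempty_of_even (by simpa using h)).map (homEquiv m n)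

theorem even_of_hom {m n : ℕ} (α : BrauerCat.mk m ⟶ BrauerCat.mk n) : Even (m + n) := by
  simpa using ((homEquiv m n).symm α).even_card

theorem nonempty_equiv {m n k l : ℕ} (h : m + n = k + l) :
    Nonempty ((BrauerCat.mk m ⟶ BrauerCat.mk n) ≃ (BrauerCat.mk k ⟶ BrauerCat.mk l)) := by
  obtain ⟨e⟩ : Nonempty (Fin m ⊕ Fin n ≃ Fin k ⊕ Fin l) := Finite.card_eq.1 (by simpa using h)
  exact ⟨(homEquiv m n).symm.trans ((PerfectMatching.congr e).trans (homEquiv k l))⟩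

theorem subsingleton_hom {m n : ℕ} (h : m + n ≤ 2) :
    Subsingleton (BrauerCat.mk m ⟶ BrauerCat.mk n) :=
  have := PerfectMatching.subsingleton_of_card_le_two (V := Fin m ⊕ Fin n) (by simpa using h)
  (homEquiv m n).symm.subsingleton

theorem eq_or_le_two_of_card_hom_eq {m n k l : ℕ} (hmn : Even (m + n)) (hkl : Even (k + l))
    (h : Nat.card (BrauerCat.mk m ⟶ BrauerCat.mk n) =
      Nat.card (BrauerCat.mk k ⟶ BrauerCat.mk l)) :
    m + n = k + l ∨ (m + n ≤ 2 ∧ k + l ≤ 2) := by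
  rw [← Nat.card_congr (homEquiv m n), ← Nat.card_congr (homEquiv k l)] at h
  simpa using PerfectMatching.eq_or_le_two_of_card_eq (by simpa using hmn) (by simpa using hkl) h

end BrauerCat

/-! ## Ranks of products -/

namespace Diagram

variable {X Y Z W : Type*}

theorem comp_inl_inl {α : Setoid (X ⊕ Y)} (β : Setoid (Y ⊕ Z)) {x x' : X}
    (h : α (Sum.inl x) (Sum.inl x')) : comp α β (Sum.inl x) (Sum.inl x') :=
  (le_sup_left : Setoid.map α upperPart ≤ _) (Setoid.le_comap_map (f := upperPart) h)

theorem comp_inr_inr (α : Setoid (X ⊕ Y)) {β : Setoid (Y ⊕ Z)} {z z' : Z}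
    (h : β (Sum.inr z) (Sum.inr z')) : comp α β (Sum.inr z) (Sum.inr z') :=
  (le_sup_right : Setoid.map β lowerPart ≤ _) (Setoid.le_comap_map (f := lowerPart) h)

theorem comp_inl_inr {α : Setoid (X ⊕ Y)} {β : Setoid (Y ⊕ Z)} {x : X} {y : Y} {z : Z}
    (h₁ : α (Sum.inl x) (Sum.inr y)) (h₂ : β (Sum.inl y) (Sum.inr z)) :
    comp α β (Sum.inl x) (Sum.inr z) :=
  Setoid.trans' (Setoid.map α upperPart ⊔ Setoid.map β lowerPart) (y := Sum.inr (Sum.inl y))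
    ((le_sup_left : Setoid.map α upperPart ≤ _) (Setoid.le_comap_map (f := upperPart) h₁))
    ((le_sup_right : Setoid.map β lowerPart ≤ _) (Setoid.le_comap_map (f := lowerPart) h₂))

/-- The partition into the connected components of the product graph. -/
abbrev components (α : Setoid (X ⊕ Y)) (β : Setoid (Y ⊕ Z)) : Setoid (X ⊕ (Y ⊕ Z)) :=
  Setoid.map α upperPart ⊔ Setoid.map β lowerPart

/-- A vertex set closed under the blocks of `α` and of `β` is a union of components: both partitions
refine the partition into `K` and its complement. -/
theorem components_le_ker {α : Setoid (X ⊕ Y)} {β : Setoid (Y ⊕ Z)} {K : Set (X ⊕ (Y ⊕ Z))}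
    (hα : ∀ u v, α u v → upperPart u ∈ K → upperPart v ∈ K)
    (hβ : ∀ u v, β u v → lowerPart u ∈ K → lowerPart v ∈ K) {u v : X ⊕ (Y ⊕ Z)}
    (h : components α β u v) (hu : u ∈ K) : v ∈ K := by
  have key : components α β ≤ Setoid.ker (· ∈ K) :=
    sup_le (map_le_iff.2 fun u v h => propext ⟨hα u v h, hα v u (α.symm' h)⟩)
      (map_le_iff.2 fun u v h => propext ⟨hβ u v h, hβ v u (β.symm' h)⟩)
  have e : (u ∈ K) = (v ∈ K) := key h
  exact e ▸ hu

/-- If no upper vertex in the component of `x` were on a transversal of `α`, these upper vertices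
would be closed under both partitions and make up the whole component, which could not reach `z`. -/
theorem exists_transversal_left {α : Setoid (X ⊕ Y)} {β : Setoid (Y ⊕ Z)} {x : X} {z : Z}
    (h : comp α β (Sum.inl x) (Sum.inr z)) :
    ∃ x', components α β (Sum.inl x) (Sum.inl x') ∧ ∃ y, α (Sum.inl x') (Sum.inr y) := by
  by_contra! hne
  have := components_le_ker (K := {v | ∃ x', v = Sum.inl x' ∧
    components α β (Sum.inl x) (Sum.inl x')}) ?_ ?_ h ⟨x, rfl, Setoid.refl' _ _⟩
  · obtain ⟨x', hx', -⟩ := this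
    simp [outerPart] at hx'
  · rintro (a | a) (b | b) hab ⟨x', hx', hr⟩
    · obtain rfl : a = x' := Sum.inl_injective hx'
      exact ⟨b, rfl, Setoid.trans' _ hr ((le_sup_left : Setoid.map α upperPart ≤ _)
        (Setoid.le_comap_map (f := upperPart) hab))⟩
    · obtain rfl : a = x' := Sum.inl_injective hx'
      exact absurd hab (hne a hr b)
    · simp [upperPart] at hx'
    · simp [upperPart] at hx'
  · rintro a b - ⟨x', hx', -⟩
    simp [lowerPart] at hx'

theorem exists_transversal_right {α : Setoid (X ⊕ Y)} {β : Setoid (Y ⊕ Z)} {x : X} {z : Z}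
    (h : comp α β (Sum.inl x) (Sum.inr z)) :
    ∃ z', components α β (Sum.inr (Sum.inr z)) (Sum.inr (Sum.inr z')) ∧
      ∃ y, β (Sum.inl y) (Sum.inr z') := by
  by_contra! hne
  have := components_le_ker (K := {v | ∃ z', v = Sum.inr (Sum.inr z') ∧
    components α β (Sum.inr (Sum.inr z)) (Sum.inr (Sum.inr z'))}) ?_ ?_ (Setoid.symm' _ h)
    ⟨z, rfl, Setoid.refl' _ _⟩
  · obtain ⟨x', hx', -⟩ := this
    simp [outerPart] at hx'
  · rintro (a | a) b - ⟨x', hx', -⟩ <;> simp [upperPart] at hx'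
  · rintro (a | a) (b | b) hab ⟨z', hz', hr⟩
    · simp [lowerPart] at hz'
    · simp [lowerPart] at hz'
    · obtain rfl : a = z' := Sum.inr_injective (Sum.inr_injective hz')
      exact absurd (β.symm' hab) (hne a hr b)
    · obtain rfl : a = z' := Sum.inr_injective (Sum.inr_injective hz')
      exact ⟨b, rfl, Setoid.trans' _ hr ((le_sup_right : Setoid.map β lowerPart ≤ _)
        (Setoid.le_comap_map (f := lowerPart) hab))⟩

/-- A transversal has two vertices, one of them lower, so it has exactly one upper vertex to
represent it. -/
theorem IsBrauer.rank_eq_card_left {α : Setoid (X ⊕ Y)} (h : IsBrauer α) :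
    rank α = Nat.card {x : X // ∃ y, α (Sum.inl x) (Sum.inr y)} := by
  have e : {A ∈ α.classes | (∃ x : X, Sum.inl x ∈ A) ∧ ∃ y : Y, Sum.inr y ∈ A} =
      (fun x : X => {v | α v (Sum.inl x)}) '' {x | ∃ y, α (Sum.inl x) (Sum.inr y)} := by
    ext A
    constructor
    · rintro ⟨⟨u, rfl⟩, ⟨x, hx⟩, y, hy⟩
      refine ⟨x, ⟨y, α.trans' hx (α.symm' hy)⟩, ?_⟩
      ext v
      exact ⟨fun hv => α.trans' hv hx, fun hv => α.trans' hv (α.symm' hx)⟩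
    · rintro ⟨x, ⟨y, hy⟩, rfl⟩
      exact ⟨α.mem_classes _, ⟨x, α.refl' _⟩, y, α.symm' hy⟩
  rw [rank, e, Set.InjOn.ncard_image]
  · rfl
  · rintro x ⟨y, hy⟩ x' - hxx
    by_contra hne
    have hr : α (Sum.inl x) (Sum.inl x') := by
      have : Sum.inl x ∈ {v | α v (Sum.inl x)} := α.refl' _
      rw [show {v | α v (Sum.inl x)} = {v | α v (Sum.inl x')} from hxx] at this
      exact this
    exact Sum.inl_ne_inr (h.eq_of_rel hr hy (fun h => hne (Sum.inl_injective h).symm) (by simp))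

theorem IsBrauer.rank_eq_card_right {α : Setoid (X ⊕ Y)} (h : IsBrauer α) :
    rank α = Nat.card {y : Y // ∃ x, α (Sum.inl x) (Sum.inr y)} := by
  rw [h.rank_eq_card_left]
  refine Nat.card_congr (Equiv.ofBijective
    (fun x => ⟨x.2.choose, x.1, x.2.choose_spec⟩) ⟨fun x x' hxx => ?_, ?_⟩)
  · have e : x.2.choose = x'.2.choose := congrArg Subtype.val hxx
    have h₁ := x.2.choose_spec
    have h₂ := x'.2.choose_spec
    rw [← e] at h₂
    exact Subtype.ext (Sum.inl_injective
      (h.eq_of_rel (α.symm' h₁) (α.symm' h₂) (by simp) (by simp)))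
  · rintro ⟨y, x, hxy⟩
    have hx : ∃ y, α (Sum.inl x) (Sum.inr y) := ⟨y, hxy⟩
    exact ⟨⟨x, hx⟩, Subtype.ext (Sum.inr_injective
      (h.eq_of_rel hx.choose_spec hxy (by simp) (by simp)))⟩

/-- Each transversal of the product shares its component with the upper end of some transversal of
`α`. This choice is injective, since a component contains at most one transversal of the product. -/
theorem IsBrauer.rank_comp_le_left [Finite X] [Finite Y] [Finite Z] {α : Setoid (X ⊕ Y)}
    {β : Setoid (Y ⊕ Z)} (hα : IsBrauer α) (hβ : IsBrauer β) : rank (Diagram.comp α β) ≤ rank α := by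
  rw [(hα.comp hβ).rank_eq_card_left, hα.rank_eq_card_left]
  choose g hg hg' using fun x : {x : X // ∃ z, Diagram.comp α β (Sum.inl x) (Sum.inr z)} =>
    exists_transversal_left x.2.choose_spec
  refine Nat.card_le_card_of_injective (fun x => ⟨g x, hg' x⟩) fun x x' h => ?_
  have e : g x = g x' := congrArg Subtype.val h
  have hr : Diagram.comp α β (Sum.inl x.1) (Sum.inl x'.1) :=
    (components α β).trans' (e ▸ hg x : components α β _ (Sum.inl (g x')))
      ((components α β).symm' (hg x'))
  by_contra hne
  exact Sum.inl_ne_inr ((hα.comp hβ).eq_of_rel hr x.2.choose_spec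
    (fun h => hne (Subtype.ext (Sum.inl_injective h).symm)) (by simp))

theorem IsBrauer.rank_comp_le_right [Finite X] [Finite Y] [Finite Z] {α : Setoid (X ⊕ Y)}
    {β : Setoid (Y ⊕ Z)} (hα : IsBrauer α) (hβ : IsBrauer β) : rank (Diagram.comp α β) ≤ rank β := by
  rw [(hα.comp hβ).rank_eq_card_right, hβ.rank_eq_card_right]
  choose g hg hg' using fun z : {z : Z // ∃ x, Diagram.comp α β (Sum.inl x) (Sum.inr z)} =>
    exists_transversal_right z.2.choose_spec
  refine Nat.card_le_card_of_injective (fun z => ⟨g z, hg' z⟩) fun z z' h => ?_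
  have e : g z = g z' := congrArg Subtype.val h
  have hr : Diagram.comp α β (Sum.inr z.1) (Sum.inr z'.1) :=
    (components α β).trans' (e ▸ hg z : components α β _ (Sum.inr (Sum.inr (g z'))))
      ((components α β).symm' (hg z'))
  by_contra hne
  exact Sum.inr_ne_inl ((hα.comp hβ).eq_of_rel hr (Setoid.symm' _ z.2.choose_spec)
    (fun h => hne (Subtype.ext (Sum.inr_injective h).symm)) (by simp))

/-! ## Relabelling -/

theorem IsBrauer.comap {V : Type*} {α : Setoid (X ⊕ Y)} (h : IsBrauer α) (e : V ⊕ W ≃ X ⊕ Y) :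
    IsBrauer (Setoid.comap e α) := by
  rw [isBrauer_iff_existsUnique] at h ⊢
  intro u
  obtain ⟨v, ⟨hv, hr⟩, huniq⟩ := h (e u)
  refine ⟨e.symm v, ⟨fun h => hv (by rw [← h, e.apply_symm_apply]), ?_⟩, fun w hw => ?_⟩
  · rwa [Setoid.comap_rel, e.apply_symm_apply]
  · rw [← huniq (e w) ⟨fun h => hw.1 (e.injective h), hw.2⟩, e.symm_apply_apply]

theorem comp_comap_le {X' Y' Z' : Type*} (f : X' → X) (g : Y' → Y) (h : Z' → Z)
    (α : Setoid (X ⊕ Y)) (β : Setoid (Y ⊕ Z)) :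
    comp (Setoid.comap (Sum.map f g) α) (Setoid.comap (Sum.map g h) β) ≤
      Setoid.comap (Sum.map f h) (comp α β) := by
  have key : components (Setoid.comap (Sum.map f g) α) (Setoid.comap (Sum.map g h) β) ≤
      Setoid.comap (Sum.map f (Sum.map g h)) (components α β) := by
    refine sup_le (map_le_iff.2 fun u v huv => ?_) (map_le_iff.2 fun u v huv => ?_)
    · have := (le_sup_left : _ ≤ components α β) (Setoid.le_comap_map (f := upperPart) huv)
      rcases u with u | u <;> rcases v with v | v <;> exact this
    · exact (le_sup_right : _ ≤ components α β) (Setoid.le_comap_map (f := lowerPart) huv)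
  intro u v huv
  have := key huv
  rcases u with u | u <;> rcases v with v | v <;> exact this

/-- Relabelling maps connected vertices of the product graph to connected ones, which gives one
inclusion; between Brauer partitions that is an equality. -/
theorem comp_comap_equiv [Finite X] [Finite Y] [Finite Z] {α : Setoid (X ⊕ Y)}
    {β : Setoid (Y ⊕ Z)} (hα : IsBrauer α) (hβ : IsBrauer β) (f : X ≃ X) (g : Y ≃ Y)
    (h : Z ≃ Z) :
    comp (Setoid.comap (Equiv.sumCongr f g) α) (Setoid.comap (Equiv.sumCongr g h) β) =
      Setoid.comap (Equiv.sumCongr f h) (comp α β) :=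
  ((hα.comap _).comp (hβ.comap _)).eq_of_le ((hα.comp hβ).comap _)
    (comp_comap_le f g h α β)

/-- The partition `α` turned upside down. -/
def flip (α : Setoid (X ⊕ Y)) : Setoid (Y ⊕ X) := Setoid.comap (Equiv.sumComm Y X) α

theorem IsBrauer.flip {α : Setoid (X ⊕ Y)} (h : IsBrauer α) : IsBrauer (flip α) := h.comap _

theorem IsBrauer.rank_flip {α : Setoid (X ⊕ Y)} (h : IsBrauer α) :
    rank (Diagram.flip α) = rank α := by
  rw [h.flip.rank_eq_card_left, h.rank_eq_card_right]
  exact Nat.card_congr (Equiv.subtypeEquivRight fun y => exists_congr fun x =>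
    ⟨fun hr => α.symm' hr, fun hr => α.symm' hr⟩)

end Diagram

/-! ## Factorizations through a partition of larger rank -/

namespace Diagram

variable {X Y Z W : Type*}

/-- The prescribed upper pairs `P` and transversals `Q` form a partial matching, which
`PerfectMatching.exists_extend` completes by parity. -/
theorem exists_isBrauer_of_partial [Finite X] [Finite Y] (hXY : Even (Nat.card X + Nat.card Y))
    (P : X → X → Prop) (Q : X → Y → Prop) (hPsymm : ∀ x x', P x x' → P x' x)
    (hPirrefl : ∀ x, ¬ P x x) (hP : ∀ x y z, P x y → P x z → y = z)
    (hQ : ∀ x y z, Q x y → Q x z → y = z) (hQ' : ∀ x x' y, Q x y → Q x' y → x = x')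
    (hPQ : ∀ x x' y, P x x' → ¬ Q x y) :
    ∃ α : Setoid (X ⊕ Y), IsBrauer α ∧ (∀ x x', P x x' → α (Sum.inl x) (Sum.inl x')) ∧
      ∀ x y, Q x y → α (Sum.inl x) (Sum.inr y) := by
  let R : X ⊕ Y → X ⊕ Y → Prop := fun u v =>
    Sum.elim (fun x => Sum.elim (P x) (Q x) v)
      (fun y => Sum.elim (fun x => Q x y) (fun _ => False) v) u
  obtain ⟨f, hf⟩ := PerfectMatching.exists_extend (V := X ⊕ Y) (by simpa using hXY) R
    (by
      rintro (x | y) (x' | y') h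
      · exact hPsymm x x' h
      · exact h
      · exact h
      · exact h)
    (by
      rintro (x | y) h
      · exact hPirrefl x h
      · exact h)
    (by
      rintro (x | y) (x' | y') (x'' | y'') h h'
      · exact congrArg _ (hP x x' x'' h h')
      · exact absurd h' (hPQ x x' y'' h)
      · exact absurd h (hPQ x x'' y' h')
      · exact congrArg _ (hQ x y' y'' h h')
      · exact congrArg _ (hQ' x' x'' y h h')
      · exact h'.elim
      · exact h.elim
      · exact h.elim)
  exact ⟨ofMatching f, isBrauer_ofMatching f, fun x x' h => Or.inr (hf (Sum.inl x) (Sum.inl x') h).symm,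
    fun x y h => Or.inr (hf (Sum.inl x) (Sum.inr y) h).symm⟩

/-- An embedding `j` routes the transversals of `ρ` through distinct transversals of `τ`. The outer
factors copy the upper and lower blocks of `ρ` and lead its transversals into and out of those of
`τ`; all other vertices are paired arbitrarily. The product then contains `ρ`, and
`IsBrauer.eq_of_le` makes it equal to `ρ`. -/
theorem IsBrauer.exists_eq_comp [Finite X] [Finite Y] [Finite Z] [Finite W] {ρ : Setoid (X ⊕ W)}
    {τ : Setoid (Y ⊕ Z)} (hρ : IsBrauer ρ) (hτ : IsBrauer τ) (h : rank ρ ≤ rank τ)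
    (hXY : Even (Nat.card X + Nat.card Y)) (hWZ : Even (Nat.card W + Nat.card Z)) :
    ∃ (α : Setoid (X ⊕ Y)) (β : Setoid (Z ⊕ W)), IsBrauer α ∧ IsBrauer β ∧
      Diagram.comp α (Diagram.comp τ β) = ρ := by
  rw [hρ.rank_eq_card_left, hτ.rank_eq_card_left] at h
  obtain ⟨j⟩ : Nonempty ({x // ∃ w, ρ (Sum.inl x) (Sum.inr w)} ↪
      {y // ∃ z, τ (Sum.inl y) (Sum.inr z)}) := by
    have := Fintype.ofFinite {x // ∃ w, ρ (Sum.inl x) (Sum.inr w)}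
    have := Fintype.ofFinite {y // ∃ z, τ (Sum.inl y) (Sum.inr z)}
    rw [Nat.card_eq_fintype_card, Nat.card_eq_fintype_card] at h
    exact Function.Embedding.nonempty_of_card_le h
  obtain ⟨α, hα, hα₁, hα₂⟩ := exists_isBrauer_of_partial hXY
    (fun x x' => x ≠ x' ∧ ρ (Sum.inl x) (Sum.inl x'))
    (fun x y => ∃ hx, (j ⟨x, hx⟩).1 = y)
    (fun x x' h => ⟨h.1.symm, ρ.symm' h.2⟩) (fun x h => h.1 rfl)
    (fun x y z h h' => Sum.inl_injective (hρ.eq_of_rel h.2 h'.2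
      (fun e => h.1 (Sum.inl_injective e).symm) (fun e => h'.1 (Sum.inl_injective e).symm)))
    (by rintro x _ _ ⟨hx, rfl⟩ ⟨hx', rfl⟩; rfl)
    (by
      rintro x x' _ ⟨hx, rfl⟩ ⟨hx', e⟩
      exact congrArg Subtype.val (j.injective (Subtype.ext e)).symm)
    (by
      rintro x x' _ h ⟨⟨w, hw⟩, -⟩
      exact Sum.inl_ne_inr (hρ.eq_of_rel h.2 hw (fun e => h.1 (Sum.inl_injective e).symm)
        (by simp)))
  -- The right factor is built upside down, since only upper pairs and transversals can be
  -- prescribed; it is flipped afterwards.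
  obtain ⟨β, hβ, hβ₁, hβ₂⟩ := exists_isBrauer_of_partial hWZ
    (fun w w' => w ≠ w' ∧ ρ (Sum.inr w) (Sum.inr w'))
    (fun w z => ∃ x : {x // ∃ w, ρ (Sum.inl x) (Sum.inr w)},
      ρ (Sum.inl x.1) (Sum.inr w) ∧ τ (Sum.inl (j x).1) (Sum.inr z))
    (fun x x' h => ⟨h.1.symm, ρ.symm' h.2⟩) (fun x h => h.1 rfl)
    (fun x y z h h' => Sum.inr_injective (hρ.eq_of_rel h.2 h'.2
      (fun e => h.1 (Sum.inr_injective e).symm) (fun e => h'.1 (Sum.inr_injective e).symm)))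
    (by
      rintro w z z' ⟨x, hx, hz⟩ ⟨x', hx', hz'⟩
      obtain rfl : x = x' := Subtype.ext (Sum.inl_injective
        (hρ.eq_of_rel (ρ.symm' hx) (ρ.symm' hx') (by simp) (by simp)))
      exact Sum.inr_injective (hτ.eq_of_rel hz hz' (by simp) (by simp)))
    (by
      rintro w w' z ⟨x, hx, hz⟩ ⟨x', hx', hz'⟩
      obtain rfl : x = x' := j.injective (Subtype.ext (Sum.inl_injective
        (hτ.eq_of_rel (τ.symm' hz) (τ.symm' hz') (by simp) (by simp))))
      exact Sum.inr_injective (hρ.eq_of_rel hx hx' (by simp) (by simp)))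
    (by
      rintro w w' _ h ⟨x, hx, -⟩
      exact Sum.inl_ne_inr (hρ.eq_of_rel (ρ.symm' hx) h.2 (by simp)
        (fun e => h.1 (Sum.inr_injective e).symm)))
  refine ⟨α, Diagram.flip β, hα, hβ.flip, (hρ.eq_of_le (hα.comp (hτ.comp hβ.flip)) ?_).symm⟩
  have key : ∀ x w, ρ (Sum.inl x) (Sum.inr w) →
      Diagram.comp α (Diagram.comp τ (Diagram.flip β)) (Sum.inl x) (Sum.inr w) := by
    intro x w hxw
    obtain ⟨z, hz⟩ := (j ⟨x, w, hxw⟩).2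
    exact comp_inl_inr (hα₂ x _ ⟨⟨w, hxw⟩, rfl⟩)
      (comp_inl_inr hz (β.symm' (hβ₂ w z ⟨⟨x, w, hxw⟩, hxw, hz⟩)))
  rintro (x | w) (x' | w') huv
  · by_cases e : x = x'
    · rw [e]
    · exact comp_inl_inl _ (hα₁ x x' ⟨e, huv⟩)
  · exact key x w' huv
  · exact Setoid.symm' _ (key x' w (ρ.symm' huv))
  · by_cases e : w = w'
    · rw [e]
    · exact comp_inr_inr _ (comp_inr_inr _ (hβ₁ w w' ⟨e, huv⟩))

/-! ## Partitions of equal rank -/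

/-- The involution of the upper vertices that fixes the ends of transversals and swaps the
ends of the other upper blocks. -/
def upperInvolution (f : PerfectMatching (X ⊕ Y)) (x : X) : X :=
  Sum.elim id (fun _ => x) (f.1 (Sum.inl x))

/-- The involution of the lower vertices that fixes the ends of transversals and swaps the
ends of the other lower blocks. -/
def lowerInvolution (f : PerfectMatching (X ⊕ Y)) (y : Y) : Y :=
  Sum.elim (fun _ => y) id (f.1 (Sum.inr y))

theorem upperInvolution_of_inl {f : PerfectMatching (X ⊕ Y)} {x x' : X}
    (h : f.1 (Sum.inl x) = Sum.inl x') : upperInvolution f x = x' := by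
  simp [upperInvolution, h]

theorem upperInvolution_of_inr {f : PerfectMatching (X ⊕ Y)} {x : X} {y : Y}
    (h : f.1 (Sum.inl x) = Sum.inr y) : upperInvolution f x = x := by
  simp [upperInvolution, h]

theorem lowerInvolution_of_inr {f : PerfectMatching (X ⊕ Y)} {y y' : Y}
    (h : f.1 (Sum.inr y) = Sum.inr y') : lowerInvolution f y = y' := by
  simp [lowerInvolution, h]

theorem lowerInvolution_of_inl {f : PerfectMatching (X ⊕ Y)} {x : X} {y : Y}
    (h : f.1 (Sum.inr y) = Sum.inl x) : lowerInvolution f y = y := by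
  simp [lowerInvolution, h]

theorem matching_symm {f : PerfectMatching (X ⊕ Y)} {u v : X ⊕ Y} (h : f.1 u = v) :
    f.1 v = u := by
  rw [← h, f.2.1]

theorem upperInvolution_involutive (f : PerfectMatching (X ⊕ Y)) :
    Function.Involutive (upperInvolution f) := by
  intro x
  rcases h : f.1 (Sum.inl x) with x' | y
  · rw [upperInvolution_of_inl h, upperInvolution_of_inl (matching_symm h)]
  · rw [upperInvolution_of_inr h, upperInvolution_of_inr h]

theorem lowerInvolution_involutive (f : PerfectMatching (X ⊕ Y)) :
    Function.Involutive (lowerInvolution f) := by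
  intro y
  rcases h : f.1 (Sum.inr y) with x | y'
  · rw [lowerInvolution_of_inl h, lowerInvolution_of_inl h]
  · rw [lowerInvolution_of_inr h, lowerInvolution_of_inr (matching_symm h)]

theorem upperInvolution_eq_self_iff {f : PerfectMatching (X ⊕ Y)} {x : X} :
    upperInvolution f x = x ↔ ∃ y, f.1 (Sum.inl x) = Sum.inr y := by
  rcases h : f.1 (Sum.inl x) with x' | y
  · rw [upperInvolution_of_inl h]
    refine iff_of_false (fun e => f.2.2 _ (e ▸ h)) (by simp)
  · simp [upperInvolution_of_inr h]

theorem lowerInvolution_eq_self_iff {f : PerfectMatching (X ⊕ Y)} {y : Y} :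
    lowerInvolution f y = y ↔ ∃ x, f.1 (Sum.inr y) = Sum.inl x := by
  rcases h : f.1 (Sum.inr y) with x | y'
  · simp [lowerInvolution_of_inl h]
  · rw [lowerInvolution_of_inr h]
    refine iff_of_false (fun e => f.2.2 _ (e ▸ h)) (by simp)

theorem ofMatching_inl_inr {f : PerfectMatching (X ⊕ Y)} {x : X} {y : Y} :
    ofMatching f (Sum.inl x) (Sum.inr y) ↔ f.1 (Sum.inl x) = Sum.inr y := by
  rw [ofMatching_iff, or_iff_right (by simp), eq_comm]

theorem card_fixedPoints_upperInvolution (f : PerfectMatching (X ⊕ Y)) :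
    Nat.card (Function.fixedPoints (upperInvolution f)) = rank (ofMatching f) := by
  rw [(isBrauer_ofMatching f).rank_eq_card_left]
  refine Nat.card_congr (Equiv.subtypeEquivRight fun x => ?_)
  simp only [ofMatching_inl_inr]
  exact upperInvolution_eq_self_iff

theorem card_fixedPoints_lowerInvolution (f : PerfectMatching (X ⊕ Y)) :
    Nat.card (Function.fixedPoints (lowerInvolution f)) = rank (ofMatching f) := by
  rw [(isBrauer_ofMatching f).rank_eq_card_right]
  refine Nat.card_congr (Equiv.subtypeEquivRight fun y => ?_)
  simp only [ofMatching_inl_inr]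
  exact lowerInvolution_eq_self_iff.trans (exists_congr fun x => ⟨matching_symm, matching_symm⟩)

/-- Brauer partitions of equal rank differ by a relabelling of the vertices. -/
theorem IsBrauer.exists_comap_eq [Finite X] [Finite Y] {σ τ : Setoid (X ⊕ Y)} (hσ : IsBrauer σ)
    (hτ : IsBrauer τ) (h : rank σ = rank τ) :
    ∃ (f : X ≃ X) (g : Y ≃ Y), Setoid.comap (Equiv.sumCongr f g) τ = σ := by
  obtain ⟨s, rfl⟩ := hσ.exists_matching
  obtain ⟨t, rfl⟩ := hτ.exists_matching
  -- The fixed points are the ends of transversals, so equal ranks make the involutions conjugate in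
  -- each row.
  obtain ⟨f, hf⟩ := (upperInvolution_involutive s).exists_conj (upperInvolution_involutive t)
    (by rw [card_fixedPoints_upperInvolution, card_fixedPoints_upperInvolution, h])
  obtain ⟨g₀, hg₀⟩ := (lowerInvolution_involutive s).exists_conj (lowerInvolution_involutive t)
    (by rw [card_fixedPoints_lowerInvolution, card_fixedPoints_lowerInvolution, h])
  have hup : ∀ x x', s.1 (Sum.inl x) = Sum.inl x' → t.1 (Sum.inl (f x)) = Sum.inl (f x') := by
    intro x x' hx
    have e := hf x
    rw [upperInvolution_of_inl hx] at e
    rcases ht : t.1 (Sum.inl (f x)) with a | b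
    · rw [e, upperInvolution_of_inl ht]
    · rw [upperInvolution_of_inr ht] at e
      exact absurd (f.injective e ▸ hx) (s.2.2 _)
  have hlow : ∀ y y', s.1 (Sum.inr y) = Sum.inr y' → t.1 (Sum.inr (g₀ y)) = Sum.inr (g₀ y') := by
    intro y y' hy
    have e := hg₀ y
    rw [lowerInvolution_of_inr hy] at e
    rcases ht : t.1 (Sum.inr (g₀ y)) with a | b
    · rw [lowerInvolution_of_inl ht] at e
      exact absurd (g₀.injective e ▸ hy) (s.2.2 _)
    · rw [e, lowerInvolution_of_inr ht]
  have htr : ∀ x y, s.1 (Sum.inl x) = Sum.inr y → ∃ y', t.1 (Sum.inl (f x)) = Sum.inr y' := by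
    intro x y hx
    rw [← upperInvolution_eq_self_iff, ← hf, upperInvolution_of_inr hx]
  -- The bijections `f` and `g₀` are chosen independently and need not carry transversals to
  -- transversals. So `g` keeps `g₀` on the nontransversal lower blocks and is redefined at the ends
  -- of transversals so as to follow `f`.
  have hex : ∀ y, ∃ y', (∀ x, s.1 (Sum.inr y) = Sum.inl x → t.1 (Sum.inl (f x)) = Sum.inr y') ∧
      ∀ y₁, s.1 (Sum.inr y) = Sum.inr y₁ → y' = g₀ y := by
    intro y
    rcases hy : s.1 (Sum.inr y) with x | y₁
    · obtain ⟨y', hy'⟩ := htr x y (matching_symm hy)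
      refine ⟨y', fun x' hx' => ?_, by simp⟩
      rw [← Sum.inl_injective hx', hy']
    · exact ⟨g₀ y, by simp, fun _ _ => rfl⟩
  choose g hg₁ hg₂ using hex
  have hlow' : ∀ y y', s.1 (Sum.inr y) = Sum.inr y' → t.1 (Sum.inr (g y)) = Sum.inr (g y') := by
    intro y y' hy
    rw [hg₂ y y' hy, hg₂ y' y (matching_symm hy), hlow y y' hy]
  have hginj : Function.Injective g := by
    intro y y' e
    rcases hy : s.1 (Sum.inr y) with x | y₁ <;> rcases hy' : s.1 (Sum.inr y') with x' | y₂
    · have h₁ := matching_symm (hg₁ y x hy)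
      have h₂ := matching_symm (hg₁ y' x' hy')
      rw [e, h₂] at h₁
      have := f.injective (Sum.inl_injective h₁)
      rw [this] at hy'
      exact Sum.inr_injective ((matching_symm hy).symm.trans (matching_symm hy'))
    · have h₁ := matching_symm (hg₁ y x hy)
      rw [e, hlow' y' y₂ hy'] at h₁
      exact absurd h₁ (by simp)
    · have h₁ := matching_symm (hg₁ y' x' hy')
      rw [← e, hlow' y y₁ hy] at h₁
      exact absurd h₁ (by simp)
    · rw [hg₂ y y₁ hy, hg₂ y' y₂ hy'] at e
      exact g₀.injective e
  let g' : Y ≃ Y := Equiv.ofBijective g (Finite.injective_iff_bijective.1 hginj)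
  refine ⟨f, g', (hσ.eq_of_le (hτ.comap _) ?_).symm⟩
  have key : ∀ u, t.1 (Equiv.sumCongr f g' u) = Equiv.sumCongr f g' (s.1 u) := by
    rintro (x | y)
    · rcases hx : s.1 (Sum.inl x) with x' | y
      · exact hup x x' hx
      · exact hg₁ y x (matching_symm hx)
    · rcases hy : s.1 (Sum.inr y) with x | y'
      · exact matching_symm (hg₁ y x hy)
      · exact hlow' y y' hy
  rintro u v (rfl | rfl)
  · exact Setoid.refl' _ _
  · exact Or.inr (key u).symm

end Diagram

/-! ## The isomorphism theorem -/

namespace BrauerCat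

variable {m n : ℕ}

/-- With `τ` a relabelling of `σ` by `f` and `g`, relabelling the morphisms in the opposite
direction by `g` and `f` is compatible with both inner compositions. -/
theorem nonempty_mulEquiv_of_rank_eq (σ τ : BrauerCat.mk n ⟶ BrauerCat.mk m)
    (h : rank σ = rank τ) : Nonempty (Sandwich σ ≃* Sandwich τ) := by
  obtain ⟨f, g, hfg⟩ := Diagram.IsBrauer.exists_comap_eq τ.2 σ.2 h.symm
  let e : (BrauerCat.mk m ⟶ BrauerCat.mk n) ≃ (BrauerCat.mk m ⟶ BrauerCat.mk n) :=
    { toFun := fun α => ⟨Setoid.comap (Equiv.sumCongr g f) α.1, α.2.comap _⟩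
      invFun := fun α => ⟨Setoid.comap (Equiv.sumCongr g f).symm α.1, α.2.comap _⟩
      left_inv := fun α => Subtype.ext (Setoid.ext fun u v => by
        simp only [Setoid.comap_rel, Equiv.apply_symm_apply])
      right_inv := fun α => Subtype.ext (Setoid.ext fun u v => by
        simp only [Setoid.comap_rel, Equiv.symm_apply_apply]) }
  have he : ∀ α β, e (α ≫ σ ≫ β) = e α ≫ τ ≫ e β := by
    intro α β
    refine Subtype.ext ?_
    change Setoid.comap (Equiv.sumCongr g f) (Diagram.comp α.1 (Diagram.comp σ.1 β.1)) =
      Diagram.comp (Setoid.comap (Equiv.sumCongr g f) α.1)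
        (Diagram.comp τ.1 (Setoid.comap (Equiv.sumCongr g f) β.1))
    rw [← hfg, Diagram.comp_comap_equiv σ.2 β.2, Diagram.comp_comap_equiv α.2 (σ.2.comp β.2)]
  exact ⟨⟨(Sandwich.of σ).symm.trans (e.trans (Sandwich.of τ)), fun α β => he α β⟩⟩

theorem exists_mul_eq_iff (σ : BrauerCat.mk n ⟶ BrauerCat.mk m)
    (ρ : BrauerCat.mk m ⟶ BrauerCat.mk n) :
    (∃ x y : Sandwich σ, x * y = Sandwich.of σ ρ) ↔ rank ρ ≤ rank σ := by
  constructor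
  · rintro ⟨x, y, h⟩
    obtain ⟨α, rfl⟩ := Sandwich.exists_of x
    obtain ⟨β, rfl⟩ := Sandwich.exists_of y
    obtain rfl : α ≫ σ ≫ β = ρ := (Sandwich.of σ).injective h
    exact (α.2.rank_comp_le_right (σ.2.comp β.2)).trans (σ.2.rank_comp_le_left β.2)
  · intro h
    obtain ⟨α, β, hα, hβ, e⟩ := Diagram.IsBrauer.exists_eq_comp ρ.2 σ.2 h
      (by simpa using even_of_hom ρ) (by simpa using even_of_hom σ)
    exact ⟨Sandwich.of σ ⟨α, hα⟩, Sandwich.of σ ⟨β, hβ⟩,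
      congrArg (Sandwich.of σ) (Subtype.ext e)⟩

/-- The number of products in a sandwich semigroup. -/
theorem card_products (σ : BrauerCat.mk n ⟶ BrauerCat.mk m) :
    Nat.card {z : Sandwich σ // ∃ x y, x * y = z} =
      {ρ : BrauerCat.mk m ⟶ BrauerCat.mk n | rank ρ ≤ rank σ}.ncard :=
  (Nat.card_congr ((Sandwich.of σ).subtypeEquiv fun ρ => (exists_mul_eq_iff σ ρ).symm)).symm

/-- A smaller rank of `σ` would give strictly fewer products: the flip of `τ` is a product for `τ`
but has too large a rank to be one for `σ`. -/
theorem rank_le_of_mulEquiv {σ τ : BrauerCat.mk n ⟶ BrauerCat.mk m}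
    (φ : Sandwich σ ≃* Sandwich τ) : rank τ ≤ rank σ := by
  by_contra! hlt
  have h : Nat.card {z : Sandwich σ // ∃ x y, x * y = z} =
      Nat.card {z : Sandwich τ // ∃ x y, x * y = z} := by
    refine Nat.card_congr (φ.toEquiv.subtypeEquiv fun z => ?_)
    change _ ↔ ∃ x y, x * y = φ z
    simp only [φ.surjective.exists, ← map_mul, φ.injective.eq_iff]
  rw [card_products, card_products] at h
  refine absurd h (Set.ncard_lt_ncard ?_ (Set.toFinite _)).ne
  refine ⟨fun ρ hρ => le_trans hρ hlt.le, fun hle => ?_⟩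
  have hmem := hle (a := (⟨Diagram.flip τ.1, τ.2.flip⟩ : BrauerCat.mk m ⟶ BrauerCat.mk n))
    τ.2.rank_flip.le
  exact absurd (τ.2.rank_flip.symm.le.trans hmem) (not_le.2 hlt)

theorem rank_le_left (σ : BrauerCat.mk n ⟶ BrauerCat.mk m) : rank σ ≤ n :=
  (σ.2.rank_eq_card_left.le.trans (Finite.card_subtype_le _)).trans_eq (Nat.card_fin n)

theorem rank_le_right (σ : BrauerCat.mk n ⟶ BrauerCat.mk m) : rank σ ≤ m :=
  (σ.2.rank_eq_card_right.le.trans (Finite.card_subtype_le _)).trans_eq (Nat.card_fin m)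

theorem rank_pos_of_left_eq_one (σ : BrauerCat.mk 1 ⟶ BrauerCat.mk m) : 0 < rank σ := by
  obtain ⟨v, ⟨hv, hr⟩, -⟩ := (Diagram.isBrauer_iff_existsUnique σ.1).1 σ.2 (Sum.inl 0)
  rcases v with x | y
  · exact absurd (congrArg Sum.inl (Subsingleton.elim x 0)) hv
  · have : Nonempty {x : Fin 1 // ∃ y, σ.1 (Sum.inl x) (Sum.inr y)} := ⟨⟨0, y, σ.1.symm' hr⟩⟩
    exact Finite.card_pos.trans_eq σ.2.rank_eq_card_left.symm

theorem rank_pos_of_right_eq_one (σ : BrauerCat.mk n ⟶ BrauerCat.mk 1) : 0 < rank σ :=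
  (rank_pos_of_left_eq_one ⟨Diagram.flip σ.1, σ.2.flip⟩).trans_eq σ.2.rank_flip

end BrauerCat

/-! ### Arithmetic of the sizes and the classification -/

/-- For opposite parities of `m` and `k`, the first alternatives of `h₁` and `h₂` together would
place `m` and `n` both one above, or both one below, `k` and `l`, against `h`. So a second
alternative holds somewhere, and it forces the sizes 0 and 1 there. -/
theorem eq_or_swap_of_add_eq {m n k l : ℕ} (hmn : m % 2 = n % 2) (hkl : k % 2 = l % 2)
    (h₁ : m + m % 2 = k + k % 2 ∨ (m + m % 2 ≤ 2 ∧ k + k % 2 ≤ 2))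
    (h₂ : m % 2 + n = k % 2 + l ∨ (m % 2 + n ≤ 2 ∧ k % 2 + l ≤ 2))
    (h : m + n = k + l) (h' : 2 < m + n) :
    (m = k ∧ n = l) ∨ (n = 0 ∧ l = 1 ∧ m = k + 1) ∨ (l = 0 ∧ n = 1 ∧ k = m + 1) ∨
      (m = 0 ∧ k = 1 ∧ n = l + 1) ∨ (k = 0 ∧ m = 1 ∧ l = n + 1) := by
  by_cases e : m = k
  · exact Or.inl ⟨e, by omega⟩
  rcases Nat.mod_two_eq_zero_or_one m with hm | hm <;>
    rcases Nat.mod_two_eq_zero_or_one k with hk | hk <;>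
    rw [hm, hk] at h₁ h₂ <;> rw [hm] at hmn <;> rw [hk] at hkl
  · exfalso
    omega
  · by_cases hn : n = 0
    · exact Or.inr (Or.inl ⟨hn, by omega, by omega⟩)
    · exact Or.inr (Or.inr (Or.inr (Or.inl ⟨by omega, by omega, by omega⟩)))
  · by_cases hl : l = 0
    · exact Or.inr (Or.inr (Or.inl ⟨hl, by omega, by omega⟩))
    · exact Or.inr (Or.inr (Or.inr (Or.inr ⟨by omega, by omega, by omega⟩)))
  · exfalso
    omega

theorem mainTheorem1 (m n k l : ℕ) (hmn : m ≡ n [MOD 2]) (hkl : k ≡ l [MOD 2])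
    (σ : BrauerCat.mk n ⟶ BrauerCat.mk m) (τ : BrauerCat.mk l ⟶ BrauerCat.mk k)
    (r s : ℕ) (hr : r = BrauerCat.rank σ) (hs : s = BrauerCat.rank τ) :
    Nonempty (Sandwich σ ≃* Sandwich τ) ↔
      (m, n, r) = (k, l, s) ∨
      (m + n ≤ 2 ∧ k + l ≤ 2) ∨
      (∃ q : ℕ, 0 < q ∧
        (((m, n, r) = (2 * q, 0, 0) ∧ (k, l, s) = (2 * q - 1, 1, 1)) ∨
          ((k, l, s) = (2 * q, 0, 0) ∧ (m, n, r) = (2 * q - 1, 1, 1)))) ∨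
      (∃ q : ℕ, 0 < q ∧
        (((m, n, r) = (0, 2 * q, 0) ∧ (k, l, s) = (1, 2 * q - 1, 1)) ∨
          ((k, l, s) = (0, 2 * q, 0) ∧ (m, n, r) = (1, 2 * q - 1, 1)))) := by
  have hmn' : m % 2 = n % 2 := hmn
  have hkl' : k % 2 = l % 2 := hkl
  simp only [Prod.mk.injEq]
  constructor
  · rintro ⟨φ⟩
    -- The objects `m % 2` and `k % 2` serve as `E` for the two semigroups; the parities may differ.
    have := BrauerCat.subsingleton_hom (m := m % 2) (n := m % 2) (by omega)
    have := BrauerCat.subsingleton_hom (m := k % 2) (n := k % 2) (by omega)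
    have em : Even (m + m % 2) := Nat.even_iff.2 (by omega)
    have en : Even (m % 2 + n) := Nat.even_iff.2 (by omega)
    have ek : Even (k + k % 2) := Nat.even_iff.2 (by omega)
    have el : Even (k % 2 + l) := Nat.even_iff.2 (by omega)
    obtain ⟨u⟩ := BrauerCat.nonempty_hom em
    obtain ⟨v⟩ := BrauerCat.nonempty_hom en
    obtain ⟨u'⟩ := BrauerCat.nonempty_hom ek
    obtain ⟨v'⟩ := BrauerCat.nonempty_hom el
    obtain ⟨h₁, h₂⟩ := Sandwich.card_eq_of_mulEquiv φ u v u' v'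
    have h₃ := Nat.card_congr ((Sandwich.of σ).trans (φ.toEquiv.trans (Sandwich.of τ).symm))
    have d₁ := BrauerCat.eq_or_le_two_of_card_hom_eq em ek h₁
    have d₂ := BrauerCat.eq_or_le_two_of_card_hom_eq en el h₂
    have d₃ := BrauerCat.eq_or_le_two_of_card_hom_eq (Nat.even_iff.2 (by omega))
      (Nat.even_iff.2 (by omega)) h₃
    have r₁ := hr.trans_le (BrauerCat.rank_le_left σ)
    have r₂ := hr.trans_le (BrauerCat.rank_le_right σ)
    have s₁ := hs.trans_le (BrauerCat.rank_le_left τ)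
    have s₂ := hs.trans_le (BrauerCat.rank_le_right τ)
    -- With the upper bounds, a row of one vertex forces rank 1 and an empty row forces rank 0, as
    -- (iii) and (iv) require.
    have r₃ : n = 1 → 0 < r := by
      rintro rfl
      exact (BrauerCat.rank_pos_of_left_eq_one σ).trans_eq hr.symm
    have r₄ : m = 1 → 0 < r := by
      rintro rfl
      exact (BrauerCat.rank_pos_of_right_eq_one σ).trans_eq hr.symm
    have s₃ : l = 1 → 0 < s := by
      rintro rfl
      exact (BrauerCat.rank_pos_of_left_eq_one τ).trans_eq hs.symm
    have s₄ : k = 1 → 0 < s := by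
      rintro rfl
      exact (BrauerCat.rank_pos_of_right_eq_one τ).trans_eq hs.symm
    have hrs : m = k → n = l → r = s := by
      rintro rfl rfl
      rw [hr, hs]
      exact le_antisymm (BrauerCat.rank_le_of_mulEquiv φ.symm) (BrauerCat.rank_le_of_mulEquiv φ)
    by_cases h22 : m + n ≤ 2 ∧ k + l ≤ 2
    · exact Or.inr (Or.inl h22)
    have h : m + n = k + l := d₃.resolve_right h22
    have h' : 2 < m + n := by
      by_contra hle
      exact h22 ⟨not_lt.1 hle, h ▸ not_lt.1 hle⟩
    have cases := eq_or_swap_of_add_eq hmn' hkl' d₁ d₂ h h'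
    clear d₁ d₂ d₃ h22 em en ek el
    rcases cases with ⟨hm, hn⟩ | c | c | c | c
    · exact Or.inl ⟨hm, hn, hrs hm hn⟩
    · exact Or.inr (Or.inr (Or.inl ⟨m / 2, by omega, Or.inl (by omega)⟩))
    · exact Or.inr (Or.inr (Or.inl ⟨k / 2, by omega, Or.inr (by omega)⟩))
    · exact Or.inr (Or.inr (Or.inr ⟨n / 2, by omega, Or.inl (by omega)⟩))
    · exact Or.inr (Or.inr (Or.inr ⟨l / 2, by omega, Or.inr (by omega)⟩))
  · have left : n ≤ 1 → l ≤ 1 → m + n = k + l → Nonempty (Sandwich σ ≃* Sandwich τ) := by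
      intro hn hl h
      have := BrauerCat.subsingleton_hom (m := n) (n := n) (by omega)
      have := BrauerCat.subsingleton_hom (m := l) (n := l) (by omega)
      exact Sandwich.nonempty_mulEquiv_of_left σ τ (BrauerCat.nonempty_equiv h)
    have right : m ≤ 1 → k ≤ 1 → m + n = k + l → Nonempty (Sandwich σ ≃* Sandwich τ) := by
      intro hm hk h
      have := BrauerCat.subsingleton_hom (m := m) (n := m) (by omega)
      have := BrauerCat.subsingleton_hom (m := k) (n := k) (by omega)
      exact Sandwich.nonempty_mulEquiv_of_right σ τ (BrauerCat.nonempty_equiv h)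
    rintro (⟨rfl, rfl, rfl⟩ | ⟨h, h'⟩ | ⟨q, hq, h | h⟩ | ⟨q, hq, h | h⟩)
    · exact BrauerCat.nonempty_mulEquiv_of_rank_eq σ τ (hr.symm.trans hs)
    -- Both semigroups have exactly one element.
    · have := BrauerCat.subsingleton_hom h
      have := BrauerCat.subsingleton_hom h'
      obtain ⟨α⟩ := BrauerCat.nonempty_hom (m := m) (n := n) (Nat.even_iff.2 (by omega))
      obtain ⟨β⟩ := BrauerCat.nonempty_hom (m := k) (n := l) (Nat.even_iff.2 (by omega))
      have := (Sandwich.of σ).symm.subsingleton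
      have := (Sandwich.of τ).symm.subsingleton
      exact ⟨⟨⟨fun _ => Sandwich.of τ β, fun _ => Sandwich.of σ α,
        fun _ => Subsingleton.elim _ _, fun _ => Subsingleton.elim _ _⟩,
        fun _ _ => Subsingleton.elim _ _⟩⟩
    · exact left (by omega) (by omega) (by omega)
    · exact left (by omega) (by omega) (by omega)
    · exact right (by omega) (by omega) (by omega)
    · exact right (by omega) (by omega) (by omega)
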